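/- Relations and calculi. For a Boolean algebra $\mathcal M$ of binary relations on a set $U$, the \emph{basic relations} of $\mathcal M$ are its atoms, and for $R,S\in\mathcal M$ the weak composition $R\diamond S$ is the smallest relation in $\mathcal M$ containing the composition $R\circ S=\{(a,c):\exists b,\ (a,b)\in R,\ (b,c)\in S\}$. A \emph{subalgebra} of $\mathcal M$ is a set $\mathcal S\subseteq\mathcal M$ that contains all basic relations of $\mathcal M$ and is closed under converse, weak composition and intersection. It is \emph{distributive} if $R\diamond(S\cap T)=(R\diamond S)\cap(R\diamond T)$ and $(S\cap T)\diamond R=(S\diamond R)\cap(T\diamond R)$ for all $R,S,T\in\mathcal S$ with $S\cap T\neq\varnothing$. A distributive subalgebra is \emph{maximal} if no other distributive subalgebra of $\mathcal M$ contains it. Interval Algebra. Let $\mathrm{IA}$ be the Boolean algebra of relations on the set of closed intervals $x=[x^-,x^+]\subset\mathbb R$, $x^-<x^+$, generated by Allen's relations $\mathsf b$ ($x^+<y^-$), $\mathsf m$ ($x^+=y^-$), $\mathsf o$ ($x^-<y^-<x^+<y^+$), $\mathsf s$ ($x^-=y^-$, $x^+<y^+$), $\mathsf d$ ($y^-<x^-$,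 $x^+<y^+$), $\mathsf f$ ($y^-<x^-$, $x^+=y^+$), $\mathsf{eq}$ ($x=y$) and the converses $\mathsf{bi},\mathsf{mi},\mathsf{oi},\mathsf{si},\mathsf{di},\mathsf{fi}$ of the first six; these thirteen relations are its basic relations. Order them by the partial order $\preceq$ generated by $\mathsf b\preceq\mathsf m\preceq\mathsf o$; $\mathsf o\preceq\mathsf s,\mathsf{fi}$; $\mathsf s\preceq\mathsf d,\mathsf{eq}$; $\mathsf{fi}\preceq\mathsf{eq},\mathsf{di}$; $\mathsf d\preceq\mathsf f$; $\mathsf{eq}\preceq\mathsf f,\mathsf{si}$; $\mathsf{di}\preceq\mathsf{si}$; $\mathsf f,\mathsf{si}\preceq\mathsf{oi}$; $\mathsf{oi}\preceq\mathsf{mi}\preceq\mathsf{bi}$ (the conceptual neighbourhood graph). Let $\mathcal C_{\mathrm{IA}}$ consist of the empty relation and all convex relations $[\theta_1,\theta_2]=\bigcup\{\theta:\theta_1\preceq\theta\preceq\theta_2\}$ with $\theta_1\preceq\theta_2$. Let $\mathcal S_{\mathrm{IA}}$ consist of all relations $\{(x,y): x^-P_1y^-,\ x^-P_2y^+,\ x^+P_3y^-,\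 x^+P_4y^+\}$, where each $P_k$ is one of $<$, $>$, $=$, $\neq$ or the universal relation on $\mathbb R$. Rectangle Algebra. A bounded region is a nonempty bounded regular closed subset $a$ of the plane $\mathbb R^2$; let $I_x(a)$ and $I_y(a)$ be the $x$- and $y$-projections of its minimum bounding (axis-parallel) rectangle. For relations $R,S$ in $\mathrm{IA}$ let $R\otimes S$ be the relation on bounded regions given by $\{(a,b): (I_x(a),I_x(b))\in R,\ (I_y(a),I_y(b))\in S\}$, and for classes $\mathcal R,\mathcal S\subseteq\mathrm{IA}$ let $\mathcal R\otimes\mathcal S=\{R\otimes S: R\in\mathcal R,\ S\in\mathcal S\}$. Let $\mathrm{RA}$ be the Boolean algebra of relations on bounded regions generated by the 169 relations $\alpha\otimes\beta$, with $\alpha,\beta$ basic relations of $\mathrm{IA}$. Theorem. $\mathrm{IA}$ has exactly two maximal distributive subalgebras, $\mathcal D_1=\mathcal C_{\mathrm{IA}}$ and $\mathcal D_2=\mathcal S_{\mathrm{IA}}$ (and these are different). $\mathrm{RA}$ has exactly four maximal distributive subalgebras, namely the Cartesian products $\mathcal D_i\otimes\mathcal D_j$, $i,j\in\{1,2\}$.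 -/

import Mathlib

namespace QCalc

open scoped SetRel

/-! ### Qualitative calculi and their distributive subalgebras

A calculus on a universe `U` is a Boolean algebra `M` of binary relations on `U`; relations are
Mathlib's `SetRel U U = Set (U × U)`, composition is `R ○ S`, converse is `R.inv`. -/

section Calculus

variable {U : Type*}

/-- The basic relations of a calculus: its atoms. -/
def basicRels (M : BooleanSubalgebra (SetRel U U)) : Set (SetRel U U) :=
  {A | A ∈ M ∧ A ≠ ∅ ∧ ∀ B ∈ M, B ⊆ A → B = ∅ ∨ B = A}

/-- The weak composition of `R` and `S`: the smallest relation of the (finite) calculus `M`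
that contains the composition `R ○ S`. -/
def weakComp (M : BooleanSubalgebra (SetRel U U)) (R S : SetRel U U) : SetRel U U :=
  ⋂₀ {T | T ∈ M ∧ R ○ S ⊆ T}

/-- A subalgebra of a calculus `M`: a class of relations of `M` that contains all basic relations
and is closed under converse, weak composition and intersection. -/
structure IsSubalgebra (M : BooleanSubalgebra (SetRel U U)) (𝒮 : Set (SetRel U U)) : Prop where
  subset : ∀ R ∈ 𝒮, R ∈ M
  basic : basicRels M ⊆ 𝒮
  inv : ∀ R ∈ 𝒮, R.inv ∈ 𝒮
  comp : ∀ R ∈ 𝒮, ∀ S ∈ 𝒮, weakComp M R S ∈ 𝒮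
  inter : ∀ R ∈ 𝒮, ∀ S ∈ 𝒮, R ∩ S ∈ 𝒮

/-- A subalgebra is distributive if weak composition distributes, on both sides, over nonempty
intersections of its relations. -/
structure IsDistributiveSubalgebra (M : BooleanSubalgebra (SetRel U U))
    (𝒮 : Set (SetRel U U)) : Prop extends IsSubalgebra M 𝒮 where
  comp_inter : ∀ R ∈ 𝒮, ∀ S ∈ 𝒮, ∀ T ∈ 𝒮, (S ∩ T).Nonempty →
    weakComp M R (S ∩ T) = weakComp M R S ∩ weakComp M R T
  inter_comp : ∀ R ∈ 𝒮, ∀ S ∈ 𝒮, ∀ T ∈ 𝒮, (S ∩ T).Nonempty →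
    weakComp M (S ∩ T) R = weakComp M S R ∩ weakComp M T R

/-- A distributive subalgebra is maximal if no other distributive subalgebra contains it. -/
def IsMaximalDistributive (M : BooleanSubalgebra (SetRel U U)) (𝒮 : Set (SetRel U U)) : Prop :=
  Maximal (IsDistributiveSubalgebra M) 𝒮

end Calculus

/-! ### The Interval Algebra -/

/-- Closed intervals `[lo, hi]` of the real line with `lo < hi`. -/
@[ext]
structure Interval where
  lo : ℝ
  hi : ℝ
  lo_lt_hi : lo < hi

/-- The names of the thirteen basic interval relations: before, meets, overlaps, starts, during,
finishes, equals, and the converses of the first six. -/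
inductive Allen
  | b | m | o | s | d | f | eq | fi | di | si | oi | mi | bi

namespace Allen

/-- The condition on the endpoints of `x` and `y` that defines each basic interval relation. -/
def Holds : Allen → Interval → Interval → Prop
  | b, x, y => x.hi < y.lo
  | m, x, y => x.hi = y.lo
  | o, x, y => x.lo < y.lo ∧ y.lo < x.hi ∧ x.hi < y.hi
  | s, x, y => x.lo = y.lo ∧ x.hi < y.hi
  | d, x, y => y.lo < x.lo ∧ x.hi < y.hi
  | f, x, y => y.lo < x.lo ∧ x.hi = y.hi
  | eq, x, y => x.lo = y.lo ∧ x.hi = y.hi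
  | fi, x, y => x.lo < y.lo ∧ y.hi = x.hi
  | di, x, y => x.lo < y.lo ∧ y.hi < x.hi
  | si, x, y => y.lo = x.lo ∧ y.hi < x.hi
  | oi, x, y => y.lo < x.lo ∧ x.lo < y.hi ∧ y.hi < x.hi
  | mi, x, y => y.hi = x.lo
  | bi, x, y => y.hi < x.lo

/-- The basic interval relation with a given name. -/
def rel (θ : Allen) : SetRel Interval Interval := {p | θ.Holds p.1 p.2}

/-- The edges of the conceptual neighbourhood graph of the basic interval relations, each directed
from the left or lower relation to its right or upper neighbour. -/
inductive Neighbour : Allen → Allen → Prop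
  | b_m : Neighbour b m
  | m_o : Neighbour m o
  | o_s : Neighbour o s
  | o_fi : Neighbour o fi
  | s_d : Neighbour s d
  | s_eq : Neighbour s eq
  | fi_eq : Neighbour fi eq
  | fi_di : Neighbour fi di
  | d_f : Neighbour d f
  | eq_f : Neighbour eq f
  | eq_si : Neighbour eq si
  | di_si : Neighbour di si
  | f_oi : Neighbour f oi
  | si_oi : Neighbour si oi
  | oi_mi : Neighbour oi mi
  | mi_bi : Neighbour mi bi

/-- The partial order on the basic interval relations given by the neighbourhood graph. -/
def Prec : Allen → Allen → Prop := Relation.ReflTransGen Neighbour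

end Allen

/-- The Interval Algebra: the algebra of relations generated by the basic interval relations. -/
def IA : BooleanSubalgebra (SetRel Interval Interval) :=
  BooleanSubalgebra.closure (Set.range Allen.rel)

/-- The convex interval relation `[θ₁, θ₂]`: the union of the basic relations between `θ₁` and
`θ₂` in the neighbourhood order. -/
def convexRel (θ₁ θ₂ : Allen) : SetRel Interval Interval :=
  ⋃ θ ∈ {θ : Allen | θ₁.Prec θ ∧ θ.Prec θ₂}, θ.rel

/-- The class of convex interval relations, together with the empty relation. -/
def convexIA : Set (SetRel Interval Interval) :=
  insert ∅ {R | ∃ θ₁ θ₂ : Allen, θ₁.Prec θ₂ ∧ R = convexRel θ₁ θ₂}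

/-- The relations `<`, `>`, `=`, `≠` and the universal relation of the Point Algebra. -/
def sPA : Set (SetRel ℝ ℝ) :=
  {{p | p.1 < p.2}, {p | p.1 > p.2}, {p | p.1 = p.2}, {p | p.1 ≠ p.2}, Set.univ}

/-- The class `S_IA`: the interval relations that are given by imposing one relation of `sPA` on
each of the four pairs consisting of an endpoint of `x` and an endpoint of `y`. -/
def sIA : Set (SetRel Interval Interval) :=
  {R | ∃ P₁ ∈ sPA, ∃ P₂ ∈ sPA, ∃ P₃ ∈ sPA, ∃ P₄ ∈ sPA,
    R = {(x, y) | (x.lo, y.lo) ∈ P₁ ∧ (x.lo, y.hi) ∈ P₂ ∧ (x.hi, y.lo) ∈ P₃ ∧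
      (x.hi, y.hi) ∈ P₄}}

/-! ### The Rectangle Algebra -/

/-- Bounded regions of the plane: nonempty bounded regular closed sets. -/
@[ext]
structure Region where
  carrier : Set (ℝ × ℝ)
  nonempty : carrier.Nonempty
  regularClosed : closure (interior carrier) = carrier
  bounded : Bornology.IsBounded carrier

namespace Region

theorem exists_box (a : Region) : ∃ p : ℝ × ℝ, ∃ ε : ℝ, 0 < ε ∧
    Metric.closedBall p ε ⊆ a.carrier := by
  have h : (interior a.carrier).Nonempty := by
    rw [← closure_nonempty_iff, a.regularClosed]
    exact a.nonempty
  obtain ⟨p, hp⟩ := h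
  obtain ⟨ε, hε, hb⟩ := Metric.nhds_basis_closedBall.mem_iff.1 (mem_interior_iff_mem_nhds.1 hp)
  exact ⟨p, ε, hε, hb⟩

theorem isBounded_fst (a : Region) : Bornology.IsBounded (Prod.fst '' a.carrier) :=
  LipschitzWith.prod_fst.isBounded_image a.bounded

theorem isBounded_snd (a : Region) : Bornology.IsBounded (Prod.snd '' a.carrier) :=
  LipschitzWith.prod_snd.isBounded_image a.bounded

theorem fst_lt (a : Region) : sInf (Prod.fst '' a.carrier) < sSup (Prod.fst '' a.carrier) := by
  obtain ⟨p, ε, hε, hb⟩ := a.exists_box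
  have h₁ : p.1 ∈ Prod.fst '' a.carrier :=
    ⟨p, hb (Metric.mem_closedBall_self hε.le), rfl⟩
  have h₂ : p.1 + ε ∈ Prod.fst '' a.carrier :=
    ⟨(p.1 + ε, p.2), hb (by simp [Prod.dist_eq, abs_of_pos hε, hε.le]), rfl⟩
  have := csInf_le a.isBounded_fst.bddBelow h₁
  have := le_csSup a.isBounded_fst.bddAbove h₂
  linarith

theorem snd_lt (a : Region) : sInf (Prod.snd '' a.carrier) < sSup (Prod.snd '' a.carrier) := by
  obtain ⟨p, ε, hε, hb⟩ := a.exists_box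
  have h₁ : p.2 ∈ Prod.snd '' a.carrier :=
    ⟨p, hb (Metric.mem_closedBall_self hε.le), rfl⟩
  have h₂ : p.2 + ε ∈ Prod.snd '' a.carrier :=
    ⟨(p.1, p.2 + ε), hb (by simp [Prod.dist_eq, abs_of_pos hε, hε.le]), rfl⟩
  have := csInf_le a.isBounded_snd.bddBelow h₁
  have := le_csSup a.isBounded_snd.bddAbove h₂
  linarith

/-- The `x`-projection of the minimum bounding rectangle of a region. -/
noncomputable def Ix (a : Region) : Interval where
  lo := sInf (Prod.fst '' a.carrier)
  hi := sSup (Prod.fst '' a.carrier)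
  lo_lt_hi := a.fst_lt

/-- The `y`-projection of the minimum bounding rectangle of a region. -/
noncomputable def Iy (a : Region) : Interval where
  lo := sInf (Prod.snd '' a.carrier)
  hi := sSup (Prod.snd '' a.carrier)
  lo_lt_hi := a.snd_lt

/-- `Ix a × Iy a` is indeed the smallest axis-parallel rectangle that contains `a`. -/
theorem isLeast_mbr (a : Region) :
    IsLeast {r : Set (ℝ × ℝ) | (∃ I J : Interval, r = Set.Icc I.lo I.hi ×ˢ Set.Icc J.lo J.hi) ∧
      a.carrier ⊆ r} (Set.Icc a.Ix.lo a.Ix.hi ×ˢ Set.Icc a.Iy.lo a.Iy.hi) := by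
  refine ⟨⟨⟨a.Ix, a.Iy, rfl⟩, fun p hp => ?_⟩, ?_⟩
  · have h₁ : p.1 ∈ Prod.fst '' a.carrier := ⟨p, hp, rfl⟩
    have h₂ : p.2 ∈ Prod.snd '' a.carrier := ⟨p, hp, rfl⟩
    exact ⟨⟨csInf_le a.isBounded_fst.bddBelow h₁, le_csSup a.isBounded_fst.bddAbove h₁⟩,
      ⟨csInf_le a.isBounded_snd.bddBelow h₂, le_csSup a.isBounded_snd.bddAbove h₂⟩⟩
  · rintro r ⟨⟨I, J, rfl⟩, h⟩
    have n₁ : (Prod.fst '' a.carrier).Nonempty := a.nonempty.image _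
    have n₂ : (Prod.snd '' a.carrier).Nonempty := a.nonempty.image _
    refine Set.prod_mono (Set.Icc_subset_Icc ?_ ?_) (Set.Icc_subset_Icc ?_ ?_)
    · exact le_csInf n₁ (by rintro _ ⟨p, hp, rfl⟩; exact (h hp).1.1)
    · exact csSup_le n₁ (by rintro _ ⟨p, hp, rfl⟩; exact (h hp).1.2)
    · exact le_csInf n₂ (by rintro _ ⟨p, hp, rfl⟩; exact (h hp).2.1)
    · exact csSup_le n₂ (by rintro _ ⟨p, hp, rfl⟩; exact (h hp).2.2)

end Region

/-- The relation `R ⊗ S` between bounded regions: the `x`-projections of the minimum bounding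
rectangles are related by `R` and their `y`-projections by `S`. -/
def tensorRel (R S : SetRel Interval Interval) : SetRel Region Region :=
  {(a, b) | (a.Ix, b.Ix) ∈ R ∧ (a.Iy, b.Iy) ∈ S}

/-- The Cartesian product of two classes of interval relations. -/
def tensorClass (𝓡 𝒮 : Set (SetRel Interval Interval)) : Set (SetRel Region Region) :=
  {Q | ∃ R ∈ 𝓡, ∃ S ∈ 𝒮, Q = tensorRel R S}

/-- The Rectangle Algebra: the algebra of relations generated by the 169 basic rectangle relations
`α ⊗ β`, where `α` and `β` are basic interval relations. -/
def RA : BooleanSubalgebra (SetRel Region Region) :=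
  BooleanSubalgebra.closure {Q | ∃ α β : Allen, Q = tensorRel α.rel β.rel}

end QCalc

/-! For a subalgebra, distributivity is equivalent to a Helly property: three pairwise intersecting
members have a common atom. The link is that the identity atom lies in `A⁻¹ ∘ B` exactly when `A`
meets `B`. Distributivity of `A⁻¹ ∘ (B ∩ C)` thus gives Helly for `A`, `B`, `C`. Conversely `c ∈ A ∘
X` means that `X` meets `A⁻¹ ∘ {c}`, so Helly for `A⁻¹ ∘ {c}`, `B`, `C` gives distributivity
(`IsDistributive.helly`, `IsDistributive.of_helly`). All of this takes place on sets of atoms;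
`Presents` carries it back to relations.

For IA, the convex and the `sIA` classes pass a finite closure and Helly check, reduced to
generators in `isDistributive_of_isClosed`. For maximality, all 8192 sets of atoms are examined. A
set that survives Helly tests against compositions of atoms is either convex or generates `{b, o}`,
and it is either in `sIA` or generates `{b, m}`. A subalgebra inside neither class would contain
both; `{b, m}` generates `{m, o}`, and `{b, o}`, `{b, m}`, `{m, o}` violate Helly
(`subset_convexClass_or_subset_sClass`).

For RA, every subalgebra contains the cylinders over the projections of its members. Helly for a
member, a vertical and a horizontal line forces the member to be a rectangle
(`IsDistributive.eq_image_prod_image`). Hence a distributive subalgebra lies in the tensor of its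
two projections. These are distributive over IA, which leaves exactly the four products. -/

namespace QCalc

open scoped SetRel

/-! ### Atom tables -/

/-- The combinatorial content of a finite calculus: `tri a b c` says that `c` is among the atoms of
the weak composition of the atoms `a` and `b`. -/
structure AtomTable (ι : Type*) where
  tri : ι → ι → ι → Prop
  conv : ι → ι
  one : ι
  conv_conv : ∀ a, conv (conv a) = a
  tri_left : ∀ {a b c}, tri a b c → tri (conv a) c b
  tri_right : ∀ {a b c}, tri a b c → tri c (conv b) a
  tri_one : ∀ {a c}, tri a one c ↔ a = c
  -- The last two conditions serve products. By the first, any atom composed with the universal set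
  -- is universal; by the second, the universal set is a composition of two atoms and so lies in
  -- every subalgebra.
  exists_tri : ∀ a c, ∃ b, tri a b c
  exists_tri_all : ∃ a b, ∀ c, tri a b c

namespace AtomTable

variable {ι κ : Type*} (P : AtomTable ι) (Q : AtomTable κ)

/-- Weak composition of sets of atoms. -/
def comp (A B : Set ι) : Set ι := {c | ∃ a ∈ A, ∃ b ∈ B, P.tri a b c}

/-- Converse of a set of atoms. -/
def inv (A : Set ι) : Set ι := P.conv ⁻¹' A

/-- Distributive subalgebras, as classes of sets of atoms. -/
structure IsDistributive (𝒜 : Set (Set ι)) : Prop where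
  singleton : ∀ a, {a} ∈ 𝒜
  inv : ∀ A ∈ 𝒜, P.inv A ∈ 𝒜
  comp : ∀ A ∈ 𝒜, ∀ B ∈ 𝒜, P.comp A B ∈ 𝒜
  inter : ∀ A ∈ 𝒜, ∀ B ∈ 𝒜, A ∩ B ∈ 𝒜
  comp_inter : ∀ A ∈ 𝒜, ∀ B ∈ 𝒜, ∀ C ∈ 𝒜, (B ∩ C).Nonempty →
    P.comp A (B ∩ C) = P.comp A B ∩ P.comp A C
  inter_comp : ∀ A ∈ 𝒜, ∀ B ∈ 𝒜, ∀ C ∈ 𝒜, (B ∩ C).Nonempty →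
    P.comp (B ∩ C) A = P.comp B A ∩ P.comp C A

variable {P Q}

/-- A triangle `(a, b, one)` rotates to `(conv a, one, b)`, which forces `b = conv a`. Nonempty
intersection becomes membership in a composition, the form on which distributivity acts. -/
theorem one_mem_comp_inv {A B : Set ι} : P.one ∈ P.comp (P.inv A) B ↔ (A ∩ B).Nonempty := by
  constructor
  · rintro ⟨a, ha, b, hb, h⟩
    have h := P.tri_one.1 (P.tri_left h)
    exact ⟨b, h ▸ ha, hb⟩
  · rintro ⟨a, ha, hb⟩
    refine ⟨P.conv a, ?_, a, hb, P.tri_left (P.tri_one.2 rfl)⟩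
    simpa [AtomTable.inv, P.conv_conv] using ha

/-- The Helly property of distributive subalgebras. -/
theorem IsDistributive.helly {𝒜 : Set (Set ι)} (h : P.IsDistributive 𝒜) {A B C : Set ι}
    (hA : A ∈ 𝒜) (hB : B ∈ 𝒜) (hC : C ∈ 𝒜) (hAB : (A ∩ B).Nonempty) (hAC : (A ∩ C).Nonempty)
    (hBC : (B ∩ C).Nonempty) : (A ∩ (B ∩ C)).Nonempty := by
  rw [← one_mem_comp_inv (P := P), h.comp_inter _ (h.inv _ hA) _ hB _ hC hBC]
  exact ⟨one_mem_comp_inv.2 hAB, one_mem_comp_inv.2 hAC⟩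

/-- A class of sets of atoms with the closure properties of a subalgebra and the Helly property is
a distributive subalgebra. -/
theorem IsDistributive.of_helly {𝒜 : Set (Set ι)} (h1 : ∀ a, {a} ∈ 𝒜)
    (hinv : ∀ A ∈ 𝒜, P.inv A ∈ 𝒜) (hcomp : ∀ A ∈ 𝒜, ∀ B ∈ 𝒜, P.comp A B ∈ 𝒜)
    (hinter : ∀ A ∈ 𝒜, ∀ B ∈ 𝒜, A ∩ B ∈ 𝒜)
    (helly : ∀ A ∈ 𝒜, ∀ B ∈ 𝒜, ∀ C ∈ 𝒜, (A ∩ B).Nonempty → (A ∩ C).Nonempty →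
      (B ∩ C).Nonempty → (A ∩ (B ∩ C)).Nonempty) : P.IsDistributive 𝒜 where
  singleton := h1
  inv := hinv
  comp := hcomp
  inter := hinter
  comp_inter A hA B hB C hC hBC := by
    refine Set.Subset.antisymm (fun c => ?_) fun c => ?_
    · rintro ⟨a, ha, b, hb, h⟩
      exact ⟨⟨a, ha, b, hb.1, h⟩, ⟨a, ha, b, hb.2, h⟩⟩
    · rintro ⟨⟨a, ha, b, hb, h⟩, ⟨a', ha', b', hb', h'⟩⟩
      -- Rotating triangles, `c` lies in the composition of `A` with `X` exactly when `X` meets the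
      -- composition of `inv A` with `{c}`. Helly is applied to that set together with `B` and `C`.
      have key := helly _ (hcomp _ (hinv _ hA) _ (h1 c)) _ hB _ hC
        ⟨b, ⟨P.conv a, by simpa [AtomTable.inv, P.conv_conv] using ha, c, rfl, P.tri_left h⟩, hb⟩
        ⟨b', ⟨P.conv a', by simpa [AtomTable.inv, P.conv_conv] using ha', c, rfl, P.tri_left h'⟩,
          hb'⟩ hBC
      obtain ⟨x, ⟨u, hu, c, rfl, hx⟩, hx'⟩ := key
      exact ⟨P.conv u, hu, x, hx', P.tri_left hx⟩
  inter_comp A hA B hB C hC hBC := by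
    refine Set.Subset.antisymm (fun c => ?_) fun c => ?_
    · rintro ⟨a, ha, b, hb, h⟩
      exact ⟨⟨a, ha.1, b, hb, h⟩, ⟨a, ha.2, b, hb, h⟩⟩
    · rintro ⟨⟨b, hb, a, ha, h⟩, ⟨b', hb', a', ha', h'⟩⟩
      have key := helly _ (hcomp _ (h1 c) _ (hinv _ hA)) _ hB _ hC
        ⟨b, ⟨c, rfl, P.conv a, by simpa [AtomTable.inv, P.conv_conv] using ha, P.tri_right h⟩, hb⟩
        ⟨b', ⟨c, rfl, P.conv a', by simpa [AtomTable.inv, P.conv_conv] using ha',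
          P.tri_right h'⟩, hb'⟩ hBC
      obtain ⟨x, ⟨c, rfl, u, hu, hx⟩, hx'⟩ := key
      exact ⟨x, hx', P.conv u, hu, P.tri_right hx⟩

/-! ### Products of atom tables -/

variable (P Q) in
/-- The product of two atom tables. -/
def prod : AtomTable (ι × κ) where
  tri a b c := P.tri a.1 b.1 c.1 ∧ Q.tri a.2 b.2 c.2
  conv a := (P.conv a.1, Q.conv a.2)
  one := (P.one, Q.one)
  conv_conv a := by simp [P.conv_conv, Q.conv_conv]
  tri_left h := ⟨P.tri_left h.1, Q.tri_left h.2⟩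
  tri_right h := ⟨P.tri_right h.1, Q.tri_right h.2⟩
  tri_one := by simp [P.tri_one, Q.tri_one, Prod.ext_iff]
  exists_tri a c := by
    obtain ⟨b, hb⟩ := P.exists_tri a.1 c.1
    obtain ⟨b', hb'⟩ := Q.exists_tri a.2 c.2
    exact ⟨(b, b'), hb, hb'⟩
  exists_tri_all := by
    obtain ⟨a, b, h⟩ := P.exists_tri_all
    obtain ⟨a', b', h'⟩ := Q.exists_tri_all
    exact ⟨(a, a'), (b, b'), fun c => ⟨h c.1, h' c.2⟩⟩

theorem comp_prod (A B : Set ι) (A' B' : Set κ) :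
    (P.prod Q).comp (A ×ˢ A') (B ×ˢ B') = P.comp A B ×ˢ Q.comp A' B' := by
  ext ⟨c, c'⟩
  constructor
  · rintro ⟨⟨a, a'⟩, ⟨ha, ha'⟩, ⟨b, b'⟩, ⟨hb, hb'⟩, h, h'⟩
    exact ⟨⟨a, ha, b, hb, h⟩, ⟨a', ha', b', hb', h'⟩⟩
  · rintro ⟨⟨a, ha, b, hb, h⟩, ⟨a', ha', b', hb', h'⟩⟩
    exact ⟨⟨a, a'⟩, ⟨ha, ha'⟩, ⟨b, b'⟩, ⟨hb, hb'⟩, h, h'⟩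

theorem comp_univ_univ : P.comp Set.univ Set.univ = Set.univ := by
  obtain ⟨a, b, h⟩ := P.exists_tri_all
  exact Set.eq_univ_of_forall fun c => ⟨a, trivial, b, trivial, h c⟩

/-- The class of products of members of two classes. -/
def tensor (𝒜 : Set (Set ι)) (ℬ : Set (Set κ)) : Set (Set (ι × κ)) :=
  {R | ∃ A ∈ 𝒜, ∃ B ∈ ℬ, R = A ×ˢ B}

theorem IsDistributive.tensor {𝒜 : Set (Set ι)} {ℬ : Set (Set κ)} (h : P.IsDistributive 𝒜)
    (h' : Q.IsDistributive ℬ) : (P.prod Q).IsDistributive (tensor 𝒜 ℬ) where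
  singleton a := ⟨_, h.singleton a.1, _, h'.singleton a.2, by simp⟩
  inv := by
    rintro _ ⟨A, hA, B, hB, rfl⟩
    exact ⟨_, h.inv _ hA, _, h'.inv _ hB, rfl⟩
  comp := by
    rintro _ ⟨A, hA, A', hA', rfl⟩ _ ⟨B, hB, B', hB', rfl⟩
    exact ⟨_, h.comp _ hA _ hB, _, h'.comp _ hA' _ hB', comp_prod ..⟩
  inter := by
    rintro _ ⟨A, hA, A', hA', rfl⟩ _ ⟨B, hB, B', hB', rfl⟩
    exact ⟨_, h.inter _ hA _ hB, _, h'.inter _ hA' _ hB', Set.prod_inter_prod⟩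
  comp_inter := by
    rintro _ ⟨A, hA, A', hA', rfl⟩ _ ⟨B, hB, B', hB', rfl⟩ _ ⟨C, hC, C', hC', rfl⟩ hne
    rw [Set.prod_inter_prod] at hne ⊢
    rw [comp_prod, comp_prod, comp_prod, h.comp_inter _ hA _ hB _ hC hne.fst,
      h'.comp_inter _ hA' _ hB' _ hC' hne.snd, Set.prod_inter_prod]
  inter_comp := by
    rintro _ ⟨A, hA, A', hA', rfl⟩ _ ⟨B, hB, B', hB', rfl⟩ _ ⟨C, hC, C', hC', rfl⟩ hne
    rw [Set.prod_inter_prod] at hne ⊢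
    rw [comp_prod, comp_prod, comp_prod, h.inter_comp _ hA _ hB _ hC hne.fst,
      h'.inter_comp _ hA' _ hB' _ hC' hne.snd, Set.prod_inter_prod]

/-- The transposed product exchanges the two factors. -/
theorem IsDistributive.swap {ℛ : Set (Set (ι × κ))} (h : (P.prod Q).IsDistributive ℛ) :
    (Q.prod P).IsDistributive {R | Prod.swap ⁻¹' R ∈ ℛ} := by
  have hc (A B : Set (κ × ι)) : Prod.swap ⁻¹' (Q.prod P).comp A B =
      (P.prod Q).comp (Prod.swap ⁻¹' A) (Prod.swap ⁻¹' B) := by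
    ext ⟨c, c'⟩
    constructor
    · rintro ⟨⟨a, a'⟩, ha, ⟨b, b'⟩, hb, h, h'⟩
      exact ⟨⟨a', a⟩, ha, ⟨b', b⟩, hb, h', h⟩
    · rintro ⟨⟨a, a'⟩, ha, ⟨b, b'⟩, hb, h, h'⟩
      exact ⟨⟨a', a⟩, ha, ⟨b', b⟩, hb, h', h⟩
  have hne {A B : Set (κ × ι)} (h : (A ∩ B).Nonempty) :
      (Prod.swap ⁻¹' A ∩ Prod.swap ⁻¹' B).Nonempty := by
    obtain ⟨x, hx⟩ := h
    exact ⟨x.swap, by simpa using hx⟩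
  have hinj : Function.Injective (Set.preimage (Prod.swap : ι × κ → κ × ι)) :=
    Prod.swap_surjective.preimage_injective
  refine ⟨fun a => ?_, fun A hA => h.inv _ hA, fun A hA B hB => ?_, fun A hA B hB =>
    h.inter _ hA _ hB, fun A hA B hB C hC hBC => hinj ?_, fun A hA B hB C hC hBC => hinj ?_⟩
  · have : Prod.swap ⁻¹' {a} = ({a.swap} : Set (ι × κ)) := by
      ext x
      simp [Prod.ext_iff, and_comm]
    rw [Set.mem_ofPred_eq, this]
    exact h.singleton _
  · rw [Set.mem_ofPred_eq, hc]
    exact h.comp _ hA _ hB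
  · rw [Set.preimage_inter, hc, hc, hc, Set.preimage_inter, h.comp_inter _ hA _ hB _ hC (hne hBC)]
  · rw [Set.preimage_inter, hc, hc, hc, Set.preimage_inter, h.inter_comp _ hA _ hB _ hC (hne hBC)]

/-- Composition with `{one} ×ˢ univ` keeps the first coordinate and forgets the second. That set is
itself a composition of two atoms, so it belongs to every subalgebra. -/
theorem IsDistributive.image_fst_prod_univ_mem {ℛ : Set (Set (ι × κ))}
    (h : (P.prod Q).IsDistributive ℛ) {R : Set (ι × κ)} (hR : R ∈ ℛ) :
    (Prod.fst '' R) ×ˢ Set.univ ∈ ℛ := by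
  obtain ⟨b, b', hb⟩ := Q.exists_tri_all
  have hcol : (P.prod Q).comp {(P.one, b)} {(P.one, b')} = {P.one} ×ˢ Set.univ := by
    ext ⟨c, c'⟩
    constructor
    · rintro ⟨_, rfl, _, rfl, h, -⟩
      exact ⟨(P.tri_one.1 h).symm, trivial⟩
    · rintro ⟨rfl, -⟩
      exact ⟨_, rfl, _, rfl, P.tri_one.2 rfl, hb _⟩
  have key : (P.prod Q).comp R ({P.one} ×ˢ Set.univ) = (Prod.fst '' R) ×ˢ Set.univ := by
    ext ⟨c, c'⟩
    constructor
    · rintro ⟨⟨a, a'⟩, ha, ⟨_, d⟩, ⟨rfl, -⟩, h, -⟩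
      exact ⟨⟨_, ha, P.tri_one.1 h⟩, trivial⟩
    · rintro ⟨⟨⟨a, a'⟩, ha, rfl⟩, -⟩
      obtain ⟨d, hd⟩ := Q.exists_tri a' c'
      exact ⟨_, ha, (P.one, d), ⟨rfl, trivial⟩, P.tri_one.2 rfl, hd⟩
  rw [← key, ← hcol]
  exact h.comp _ hR _ (h.comp _ (h.singleton _) _ (h.singleton _))

theorem IsDistributive.univ_prod_image_snd_mem {ℛ : Set (Set (ι × κ))}
    (h : (P.prod Q).IsDistributive ℛ) {R : Set (ι × κ)} (hR : R ∈ ℛ) :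
    Set.univ ×ˢ (Prod.snd '' R) ∈ ℛ := by
  have := h.swap.image_fst_prod_univ_mem (R := Prod.swap ⁻¹' R) (by
    rw [Set.mem_ofPred_eq, ← Set.preimage_comp]
    simpa using hR)
  have e : Prod.fst '' (Prod.swap ⁻¹' R) = Prod.snd '' R := by
    rw [← Set.image_swap_eq_preimage_swap, Set.image_image]
    rfl
  rw [e, Set.mem_ofPred_eq, Set.preimage_swap_prod] at this
  exact this

/-- Every member of a distributive subalgebra of a product is a rectangle. -/
theorem IsDistributive.eq_image_prod_image {ℛ : Set (Set (ι × κ))}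
    (h : (P.prod Q).IsDistributive ℛ) {R : Set (ι × κ)} (hR : R ∈ ℛ) :
    R = (Prod.fst '' R) ×ˢ (Prod.snd '' R) := by
  refine Set.Subset.antisymm (fun x hx => ⟨⟨x, hx, rfl⟩, ⟨x, hx, rfl⟩⟩) ?_
  rintro ⟨a, b'⟩ ⟨⟨⟨a, b⟩, hab, rfl⟩, ⟨⟨a', b'⟩, hab', rfl⟩⟩
  have h1 := h.image_fst_prod_univ_mem (h.singleton (a, b))
  have h2 := h.univ_prod_image_snd_mem (h.singleton (a', b'))
  rw [Set.image_singleton] at h1 h2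
  -- The lines `{a} ×ˢ univ` and `univ ×ˢ {b'}` cross only at `(a, b')`, and each of them meets `R`;
  -- Helly puts the crossing point into `R`.
  obtain ⟨⟨x, y⟩, hx, ⟨h3, -⟩, -, h4⟩ := h.helly hR h1 h2 ⟨(a, b), hab, rfl, trivial⟩
    ⟨(a', b'), hab', trivial, rfl⟩ ⟨(a, b'), ⟨rfl, trivial⟩, trivial, rfl⟩
  cases h3
  cases h4
  exact hx

/-- The cylinder map `A ↦ A ×ˢ univ` is injective and commutes with converse, intersection and,
because `univ` composed with itself is `univ`, composition. The axioms therefore pull back along it.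
-/
theorem IsDistributive.fst {ℛ : Set (Set (ι × κ))} (h : (P.prod Q).IsDistributive ℛ) :
    P.IsDistributive {A | A ×ˢ Set.univ ∈ ℛ} := by
  have hc (A B : Set ι) : P.comp A B ×ˢ (Set.univ : Set κ) =
      (P.prod Q).comp (A ×ˢ Set.univ) (B ×ˢ Set.univ) := by rw [comp_prod, comp_univ_univ]
  have hi (A B : Set ι) : (A ∩ B) ×ˢ (Set.univ : Set κ) = A ×ˢ Set.univ ∩ B ×ˢ Set.univ :=
    Set.inter_prod
  have hne {A : Set ι} (hA : A.Nonempty) : (A ×ˢ (Set.univ : Set κ)).Nonempty :=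
    hA.prod ⟨Q.one, trivial⟩
  have hinj {A B : Set ι} (hAB : A ×ˢ (Set.univ : Set κ) = B ×ˢ Set.univ) : A = B := by
    ext a
    simpa using Set.ext_iff.1 hAB (a, Q.one)
  refine ⟨fun a => ?_, fun A hA => h.inv _ hA, fun A hA B hB => ?_, fun A hA B hB => ?_,
    fun A hA B hB C hC hBC => hinj ?_, fun A hA B hB C hC hBC => hinj ?_⟩
  · simpa using h.image_fst_prod_univ_mem (h.singleton (a, Q.one))
  · rw [Set.mem_ofPred_eq, hc]
    exact h.comp _ hA _ hB
  · rw [Set.mem_ofPred_eq, hi]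
    exact h.inter _ hA _ hB
  · rw [hc, hi, hi, h.comp_inter _ hA _ hB _ hC (by rw [← hi]; exact hne hBC), hc, hc]
  · rw [hc, hi, hi, h.inter_comp _ hA _ hB _ hC (by rw [← hi]; exact hne hBC), hc, hc]

theorem IsDistributive.snd {ℛ : Set (Set (ι × κ))} (h : (P.prod Q).IsDistributive ℛ) :
    Q.IsDistributive {B | Set.univ ×ˢ B ∈ ℛ} := by
  have := h.swap.fst
  simp only [Set.mem_ofPred_eq, Set.preimage_swap_prod] at this
  exact this

theorem IsDistributive.subset_tensor {ℛ : Set (Set (ι × κ))} (h : (P.prod Q).IsDistributive ℛ) :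
    ℛ ⊆ AtomTable.tensor {A | A ×ˢ Set.univ ∈ ℛ} {B | Set.univ ×ˢ B ∈ ℛ} := fun _ hR =>
  ⟨_, h.image_fst_prod_univ_mem hR, _, h.univ_prod_image_snd_mem hR, h.eq_image_prod_image hR⟩

theorem tensor_mono {𝒜 𝒜' : Set (Set ι)} {ℬ ℬ' : Set (Set κ)} (h : 𝒜 ⊆ 𝒜') (h' : ℬ ⊆ ℬ') :
    tensor 𝒜 ℬ ⊆ tensor 𝒜' ℬ' := by
  rintro _ ⟨A, hA, B, hB, rfl⟩
  exact ⟨A, h hA, B, h' hB, rfl⟩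

theorem IsDistributive.empty_mem [Nontrivial ι] {𝒜 : Set (Set ι)} (h : P.IsDistributive 𝒜) :
    ∅ ∈ 𝒜 := by
  obtain ⟨a, b, hab⟩ := exists_pair_ne ι
  have := h.inter _ (h.singleton a) _ (h.singleton b)
  rwa [Set.singleton_inter_eq_empty.2 (by simpa using hab)] at this

/-- A nonempty product determines its factors, so each class is recovered by pairing its members
with a singleton. The empty set is treated apart; it is the intersection of two distinct singletons.
-/
theorem subset_of_tensor_subset [Nontrivial ι] [Nontrivial κ] {𝒜 𝒜' : Set (Set ι)}
    {ℬ ℬ' : Set (Set κ)} (h𝒜 : P.IsDistributive 𝒜) (hℬ : Q.IsDistributive ℬ)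
    (h𝒜' : P.IsDistributive 𝒜') (hℬ' : Q.IsDistributive ℬ')
    (h : tensor 𝒜 ℬ ⊆ tensor 𝒜' ℬ') : 𝒜 ⊆ 𝒜' ∧ ℬ ⊆ ℬ' := by
  constructor
  · intro A hA
    rcases A.eq_empty_or_nonempty with rfl | hne
    · exact h𝒜'.empty_mem
    · obtain ⟨A', hA', B', -, e⟩ := h ⟨A, hA, _, hℬ.singleton Q.one, rfl⟩
      rw [Set.prod_eq_prod_iff_of_nonempty (hne.prod (Set.singleton_nonempty _))] at e
      exact e.1 ▸ hA'
  · intro B hB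
    rcases B.eq_empty_or_nonempty with rfl | hne
    · exact hℬ'.empty_mem
    · obtain ⟨A', -, B', hB', e⟩ := h ⟨_, h𝒜.singleton P.one, B, hB, rfl⟩
      rw [Set.prod_eq_prod_iff_of_nonempty ((Set.singleton_nonempty _).prod hne)] at e
      exact e.2 ▸ hB'

end AtomTable

/-! ### Calculi presented by atom tables -/

section Presentation

variable {U ι : Type*}

/-- The relation with a given set of atoms, where `idx x y` is the atom that contains `(x, y)`. -/
def pull (idx : U → U → ι) (A : Set ι) : SetRel U U := {p | idx p.1 p.2 ∈ A}

theorem mem_closure_range_pull [Finite ι] (idx : U → U → ι) {R : SetRel U U} :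
    R ∈ BooleanSubalgebra.closure (Set.range fun a => pull idx {a}) ↔ R ∈ Set.range (pull idx) := by
  constructor
  · refine BooleanSubalgebra.closure_bot_sup_induction ?_ ⟨∅, rfl⟩ ?_ ?_
    · rintro _ ⟨a, rfl⟩
      exact ⟨_, rfl⟩
    · rintro _ - _ - ⟨A, rfl⟩ ⟨B, rfl⟩
      exact ⟨A ∪ B, rfl⟩
    · rintro _ - ⟨A, rfl⟩
      exact ⟨Aᶜ, rfl⟩
  · rintro ⟨A, rfl⟩
    induction A, A.toFinite using Set.Finite.induction_on with
    | empty => exact BooleanSubalgebra.bot_mem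
    | @insert a s _ _ ih =>
      exact BooleanSubalgebra.sup_mem (BooleanSubalgebra.subset_closure ⟨a, rfl⟩) ih

/-- The calculus `M` is presented by the atom table `P` through the atoms `idx x y`. -/
structure Presents (P : AtomTable ι) (idx : U → U → ι) (M : BooleanSubalgebra (SetRel U U)) :
    Prop where
  mem_iff : ∀ R, R ∈ M ↔ R ∈ Set.range (pull idx)
  idx_swap : ∀ x y, idx y x = P.conv (idx x y)
  tri_iff : ∀ a b c, P.tri a b c ↔ ∃ x y z, idx x y = a ∧ idx y z = b ∧ idx x z = c

namespace Presents

variable {P : AtomTable ι} {idx : U → U → ι} {M : BooleanSubalgebra (SetRel U U)}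

theorem exists_idx_eq (h : Presents P idx M) (a : ι) : ∃ x y, idx x y = a := by
  obtain ⟨x, y, z, hx, -, -⟩ := (h.tri_iff a P.one a).1 (P.tri_one.2 rfl)
  exact ⟨x, y, hx⟩

theorem pull_subset_pull (h : Presents P idx M) {A B : Set ι} :
    pull idx A ⊆ pull idx B ↔ A ⊆ B := by
  refine ⟨fun hAB a ha => ?_, fun hAB p hp => hAB hp⟩
  obtain ⟨x, y, rfl⟩ := h.exists_idx_eq a
  exact @hAB (x, y) ha

theorem pull_injective (h : Presents P idx M) : Function.Injective (pull idx) := fun _ _ e =>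
  Set.Subset.antisymm (h.pull_subset_pull.1 e.subset) (h.pull_subset_pull.1 e.symm.subset)

theorem pull_nonempty (h : Presents P idx M) {A : Set ι} : (pull idx A).Nonempty ↔ A.Nonempty := by
  constructor
  · rintro ⟨p, hp⟩
    exact ⟨_, hp⟩
  · rintro ⟨a, ha⟩
    obtain ⟨x, y, rfl⟩ := h.exists_idx_eq a
    exact ⟨(x, y), ha⟩

theorem pull_inter (A B : Set ι) : pull idx (A ∩ B) = pull idx A ∩ pull idx B := rfl

theorem inv_pull (h : Presents P idx M) (A : Set ι) : (pull idx A).inv = pull idx (P.inv A) := by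
  ext ⟨x, y⟩
  change idx y x ∈ A ↔ P.conv (idx x y) ∈ A
  rw [h.idx_swap x y]

/-- A member of `M` containing the composition must contain every atom that meets it, and `tri_iff`
says that these atoms are those of `P.comp A B`. -/
theorem weakComp_pull (h : Presents P idx M) (A B : Set ι) :
    weakComp M (pull idx A) (pull idx B) = pull idx (P.comp A B) := by
  apply Set.Subset.antisymm
  · refine Set.sInter_subset_of_mem ⟨(h.mem_iff _).2 ⟨_, rfl⟩, ?_⟩
    rintro ⟨x, z⟩ ⟨y, hxy, hyz⟩
    exact ⟨_, hxy, _, hyz, (h.tri_iff ..).2 ⟨x, y, z, rfl, rfl, rfl⟩⟩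
  · refine Set.subset_sInter ?_
    rintro T ⟨hT, hAB⟩
    obtain ⟨C, rfl⟩ := (h.mem_iff _).1 hT
    refine h.pull_subset_pull.2 ?_
    rintro c ⟨a, ha, b, hb, habc⟩
    obtain ⟨x, y, z, rfl, rfl, rfl⟩ := (h.tri_iff ..).1 habc
    exact @hAB (x, z) ⟨y, ha, hb⟩

theorem basicRels_eq (h : Presents P idx M) : basicRels M = Set.range fun a => pull idx {a} := by
  ext R
  constructor
  · rintro ⟨hR, hne, hmin⟩
    obtain ⟨A, rfl⟩ := (h.mem_iff _).1 hR
    obtain ⟨a, ha⟩ := h.pull_nonempty.1 (Set.nonempty_iff_ne_empty.2 hne)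
    refine ⟨a, (hmin _ ((h.mem_iff _).2 ⟨{a}, rfl⟩)
      (h.pull_subset_pull.2 (by simpa using ha))).resolve_left ?_⟩
    exact (h.pull_nonempty.2 (Set.singleton_nonempty a)).ne_empty
  · rintro ⟨a, rfl⟩
    refine ⟨(h.mem_iff _).2 ⟨_, rfl⟩,
      (h.pull_nonempty.2 (Set.singleton_nonempty a)).ne_empty, fun B hB hBa => ?_⟩
    obtain ⟨B, rfl⟩ := (h.mem_iff _).1 hB
    rcases Set.subset_singleton_iff_eq.1 (h.pull_subset_pull.1 hBa) with rfl | rfl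
    · exact Or.inl rfl
    · exact Or.inr rfl

/-- The distributive subalgebras of a calculus are those of its atom table. -/
theorem isDistributiveSubalgebra_iff (h : Presents P idx M) {𝒮 : Set (SetRel U U)} :
    IsDistributiveSubalgebra M 𝒮 ↔ ∃ 𝒜, P.IsDistributive 𝒜 ∧ 𝒮 = pull idx '' 𝒜 := by
  constructor
  · intro H
    refine ⟨{A | pull idx A ∈ 𝒮}, ⟨fun a => ?_, fun A hA => ?_, fun A hA B hB => ?_,
      fun A hA B hB => ?_, fun A hA B hB C hC hBC => ?_, fun A hA B hB C hC hBC => ?_⟩, ?_⟩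
    · exact H.basic (h.basicRels_eq ▸ ⟨a, rfl⟩)
    · rw [Set.mem_ofPred_eq, ← h.inv_pull]
      exact H.inv _ hA
    · rw [Set.mem_ofPred_eq, ← h.weakComp_pull]
      exact H.comp _ hA _ hB
    · exact H.inter _ hA _ hB
    · apply h.pull_injective
      rw [pull_inter, ← h.weakComp_pull, ← h.weakComp_pull, ← h.weakComp_pull, pull_inter]
      exact H.comp_inter _ hA _ hB _ hC (h.pull_nonempty.2 hBC)
    · apply h.pull_injective
      rw [pull_inter, ← h.weakComp_pull, ← h.weakComp_pull, ← h.weakComp_pull, pull_inter]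
      exact H.inter_comp _ hA _ hB _ hC (h.pull_nonempty.2 hBC)
    · ext R
      constructor
      · intro hR
        obtain ⟨A, rfl⟩ := (h.mem_iff _).1 (H.subset R hR)
        exact ⟨A, hR, rfl⟩
      · rintro ⟨A, hA, rfl⟩
        exact hA
  · rintro ⟨𝒜, H, rfl⟩
    refine ⟨⟨?_, ?_, ?_, ?_, ?_⟩, ?_, ?_⟩
    · rintro _ ⟨A, -, rfl⟩
      exact (h.mem_iff _).2 ⟨A, rfl⟩
    · rw [h.basicRels_eq]
      rintro _ ⟨a, rfl⟩
      exact ⟨_, H.singleton a, rfl⟩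
    · rintro _ ⟨A, hA, rfl⟩
      exact ⟨_, H.inv A hA, (h.inv_pull A).symm⟩
    · rintro _ ⟨A, hA, rfl⟩ _ ⟨B, hB, rfl⟩
      exact ⟨_, H.comp A hA B hB, (h.weakComp_pull A B).symm⟩
    · rintro _ ⟨A, hA, rfl⟩ _ ⟨B, hB, rfl⟩
      exact ⟨_, H.inter A hA B hB, rfl⟩
    · rintro _ ⟨A, hA, rfl⟩ _ ⟨B, hB, rfl⟩ _ ⟨C, hC, rfl⟩ hBC
      rw [← pull_inter] at hBC ⊢
      rw [h.weakComp_pull, h.weakComp_pull, h.weakComp_pull,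
        H.comp_inter _ hA _ hB _ hC (h.pull_nonempty.1 hBC), pull_inter]
    · rintro _ ⟨A, hA, rfl⟩ _ ⟨B, hB, rfl⟩ _ ⟨C, hC, rfl⟩ hBC
      rw [← pull_inter] at hBC ⊢
      rw [h.weakComp_pull, h.weakComp_pull, h.weakComp_pull,
        H.inter_comp _ hA _ hB _ hC (h.pull_nonempty.1 hBC), pull_inter]

/-- If every distributive subalgebra lies in one of the pairwise incomparable distributive
subalgebras `𝒟 i`, then these are the maximal ones. -/
theorem setOf_isMaximalDistributive (h : Presents P idx M) {J : Type*} {𝒟 : J → Set (Set ι)}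
    (hD : ∀ i, P.IsDistributive (𝒟 i)) (hle : ∀ 𝒜, P.IsDistributive 𝒜 → ∃ i, 𝒜 ⊆ 𝒟 i)
    (hanti : ∀ i j, 𝒟 i ⊆ 𝒟 j → i = j) :
    {𝒮 | IsMaximalDistributive M 𝒮} = Set.range fun i => pull idx '' 𝒟 i := by
  have hmem i : IsDistributiveSubalgebra M (pull idx '' 𝒟 i) :=
    h.isDistributiveSubalgebra_iff.2 ⟨_, hD i, rfl⟩
  ext 𝒮
  constructor
  · rintro ⟨h𝒮, hmax⟩
    obtain ⟨𝒜, H, rfl⟩ := h.isDistributiveSubalgebra_iff.1 h𝒮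
    obtain ⟨i, hi⟩ := hle 𝒜 H
    exact ⟨i, Set.Subset.antisymm (hmax (hmem i) (Set.image_mono hi)) (Set.image_mono hi)⟩
  · rintro ⟨i, rfl⟩
    refine ⟨hmem i, fun 𝒮 h𝒮 hi => ?_⟩
    obtain ⟨𝒜, H, rfl⟩ := h.isDistributiveSubalgebra_iff.1 h𝒮
    obtain ⟨j, hj⟩ := hle 𝒜 H
    have hij : 𝒟 i ⊆ 𝒜 := (Set.image_subset_image_iff h.pull_injective).1 hi
    obtain rfl := hanti i j (hij.trans hj)
    exact Set.image_mono hj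

end Presents

end Presentation

/-! ### The composition table of the Interval Algebra -/

namespace Allen

/-- The position of a basic interval relation in the list `b, m, o, s, d, f, eq, …`. -/
def idx : Allen → ℕ
  | b => 0 | m => 1 | o => 2 | s => 3 | d => 4 | f => 5 | eq => 6 | fi => 7 | di => 8 | si => 9
  | oi => 10 | mi => 11 | bi => 12

theorem idx_lt (a : Allen) : a.idx < 13 := by cases a <;> decide

theorem idx_injective : Function.Injective idx := by
  intro a a' h
  cases a <;> cases a' <;> first | rfl | exact absurd h (by decide)

theorem exists_idx_eq {i : ℕ} (hi : i < 13) : ∃ a : Allen, a.idx = i := by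
  interval_cases i
  exacts [⟨b, rfl⟩, ⟨m, rfl⟩, ⟨o, rfl⟩, ⟨s, rfl⟩, ⟨d, rfl⟩, ⟨f, rfl⟩, ⟨eq, rfl⟩, ⟨fi, rfl⟩,
    ⟨di, rfl⟩, ⟨si, rfl⟩, ⟨oi, rfl⟩, ⟨mi, rfl⟩, ⟨bi, rfl⟩]

instance : DecidableEq Allen := fun a a' =>
  if h : a.idx = a'.idx then isTrue (idx_injective h) else isFalse fun e => h (e ▸ rfl)

instance : Fintype Allen where
  elems := ⟨[b, m, o, s, d, f, eq, fi, di, si, oi, mi, bi], by decide⟩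
  complete a := by cases a <;> decide

instance : Nontrivial Allen := ⟨b, m, by decide⟩

/-- The converse of a basic interval relation. -/
def conv : Allen → Allen
  | b => bi | m => mi | o => oi | s => si | d => di | f => fi | eq => eq | fi => f | di => d
  | si => s | oi => o | mi => m | bi => b

theorem conv_conv (a : Allen) : a.conv.conv = a := by cases a <;> rfl

/-- The rows of the composition table, as bit masks: the bit `13 * β.idx + γ.idx` of `α.row` says
whether `γ` is among the atoms of the weak composition of `α` and `β`. -/
def row : Allen → ℕ
  | b => 748197840164834869584538326223373462554996709007361
  | m => 724907309837702040281248469253815391111782837788673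
  | o => 724924796366038838301190426125547390158782202912769
  | s => 374167256579022273349356168547347077725756860669953
  | d => 374190100905987106367796806480156522219460150435841
  | f => 374190100840644911379465312760232947698636158943233
  | eq => 374167256513676093110748221241606344044128455639041
  | fi => 724924796023012277445128326323025959575110243336193
  | di => 724924796023012277445445277716567313476751948022151
  | si => 374167256513676093111065269327958294593101573947783
  | oi => 374190100840644911383347792573638261292878827389319
  | mi => 374190096658744685224655802640984463211427464282503
  | bi => 374190096658744685229727024087502560727688706138111

/-- The composition table of the Interval Algebra. -/
def Tri (α β γ : Allen) : Prop := α.row.testBit (13 * β.idx + γ.idx) = true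

instance (α β γ : Allen) : Decidable (Tri α β γ) := inferInstanceAs (Decidable (_ = _))

/-- The basic relation that holds between `[x, x']` and `[y, y']`. -/
def between {α : Type*} [LinearOrder α] (x x' y y' : α) : Allen :=
  if x' < y then b else if x' = y then m else
  if y' < x then bi else if y' = x then mi else
  if x < y then if x' < y' then o else if x' = y' then fi else di
  else if x = y then if x' < y' then s else if x' = y' then eq else si
  else if x' < y' then d else if x' = y' then f else oi

theorem between_map {α β : Type*} [LinearOrder α] [LinearOrder β] {g : α → β} {F : Set α}
    (hg : StrictMonoOn g F) {x x' y y' : α} (hx : x ∈ F) (hx' : x' ∈ F) (hy : y ∈ F)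
    (hy' : y' ∈ F) : between (g x) (g x') (g y) (g y') = between x x' y y' := by
  simp only [between, hg.lt_iff_lt hx' hy, hg.lt_iff_lt hy' hx, hg.lt_iff_lt hx hy,
    hg.lt_iff_lt hx' hy', hg.injOn.eq_iff hx' hy, hg.injOn.eq_iff hy' hx, hg.injOn.eq_iff hx hy,
    hg.injOn.eq_iff hx' hy']

theorem holds_between (x y : Interval) : (between x.lo x.hi y.lo y.hi).Holds x y := by
  have := x.lo_lt_hi
  have := y.lo_lt_hi
  unfold between
  split_ifs <;> simp only [Holds] <;> grind

theorem Holds.unique {a a' : Allen} {x y : Interval} (h : a.Holds x y) (h' : a'.Holds x y) :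
    a = a' := by
  have := x.lo_lt_hi
  have := y.lo_lt_hi
  cases a <;> cases a' <;> simp only [Holds] at h h' <;> first | rfl | (exfalso; grind)

/-- The atom of the Interval Algebra that contains a given pair. -/
noncomputable def of (x y : Interval) : Allen := between x.lo x.hi y.lo y.hi

theorem of_eq_iff {x y : Interval} {a : Allen} : of x y = a ↔ a.Holds x y :=
  ⟨fun h => h ▸ holds_between x y, fun h => (holds_between x y).unique h⟩

theorem of_swap (x y : Interval) : of y x = (of x y).conv := by
  rw [of_eq_iff]
  have h := holds_between x y
  change (of x y).Holds x y at h
  revert h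
  cases of x y <;> simp only [Holds, conv] <;> tauto

/-! ### Verification of the composition table on intervals with small integer endpoints. -/

/-- The intervals with endpoints in `{0, …, 5}`. -/
def pairs : List (ℕ × ℕ) :=
  [(0, 1), (0, 2), (0, 3), (0, 4), (0, 5), (1, 2), (1, 3), (1, 4), (1, 5), (2, 3), (2, 4), (2, 5),
    (3, 4), (3, 5), (4, 5)]

theorem mem_pairs {p : ℕ × ℕ} : p ∈ pairs ↔ p.1 < p.2 ∧ p.2 < 6 := by
  constructor
  · revert p
    decide
  · obtain ⟨i, j⟩ := p
    rintro ⟨h1, h2⟩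
    change i < j at h1
    change j < 6 at h2
    interval_cases j <;> interval_cases i <;> decide

/-- The positions of the bits of `a.row`, computed from the intervals with endpoints in
`{0, …, 5}`. -/
def codes (a : Allen) : List ℕ :=
  pairs.flatMap fun p => pairs.flatMap fun q =>
    if between p.1 p.2 q.1 q.2 = a then
      pairs.map fun r => 13 * (between q.1 q.2 r.1 r.2).idx + (between p.1 p.2 r.1 r.2).idx
    else []

/-- The number whose bits are at the given positions. -/
def ofBits (l : List ℕ) : ℕ := l.foldr (fun i n => Nat.lor (2 ^ i) n) 0

theorem testBit_ofBits {l : List ℕ} {j : ℕ} : (ofBits l).testBit j = true ↔ j ∈ l := by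
  induction l with
  | nil => simp [ofBits]
  | cons i l ih =>
    change (2 ^ i ||| ofBits l).testBit j = true ↔ _
    rw [Nat.testBit_or, Bool.or_eq_true, ih, Nat.testBit_two_pow]
    simp [eq_comm]

/-- This justifies the literals in `row`. Six values suffice because three intervals have at most
six endpoints. -/
theorem ofBits_codes : ∀ a, ofBits (codes a) = a.row := by decide +kernel

theorem tri_iff_pairs {α β γ : Allen} : Tri α β γ ↔ ∃ p ∈ pairs, ∃ q ∈ pairs, ∃ r ∈ pairs,
    between p.1 p.2 q.1 q.2 = α ∧ between q.1 q.2 r.1 r.2 = β ∧ between p.1 p.2 r.1 r.2 = γ := by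
  rw [Tri, ← ofBits_codes, testBit_ofBits]
  simp only [codes, List.mem_flatMap, List.mem_ite_nil_right, List.mem_map]
  constructor
  · rintro ⟨p, hp, q, hq, h, r, hr, e⟩
    have hb := β.idx_lt
    have hc := γ.idx_lt
    have h1 := (between q.1 q.2 r.1 r.2).idx_lt
    have h2 := (between p.1 p.2 r.1 r.2).idx_lt
    exact ⟨p, hp, q, hq, r, hr, h, idx_injective (by omega), idx_injective (by omega)⟩
  · rintro ⟨p, hp, q, hq, r, hr, h, rfl, rfl⟩
    exact ⟨p, hp, q, hq, h, r, hr, rfl⟩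

/-- The map sends `t` to the number of elements of `F` below it. It replaces real endpoints by small
integers of the same order type, on which alone the atoms depend. -/
theorem exists_strictMonoOn_rank (F : Finset ℝ) :
    ∃ g : ℝ → ℕ, StrictMonoOn g F ∧ ∀ t ∈ F, g t < F.card := by
  refine ⟨fun t => (F.filter (· < t)).card, fun t ht u _ htu => Finset.card_lt_card ?_,
    fun t ht => Finset.card_lt_card ?_⟩
  · refine (Finset.ssubset_iff_of_subset fun v hv => ?_).2 ⟨t, ?_, ?_⟩
    · rw [Finset.mem_filter] at hv ⊢
      exact ⟨hv.1, hv.2.trans htu⟩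
    · exact Finset.mem_filter.2 ⟨ht, htu⟩
    · simp
  · exact (Finset.ssubset_iff_of_subset (Finset.filter_subset _ _)).2 ⟨t, ht, by simp⟩

theorem tri_iff (α β γ : Allen) :
    Tri α β γ ↔ ∃ x y z, of x y = α ∧ of y z = β ∧ of x z = γ := by
  rw [tri_iff_pairs]
  constructor
  · rintro ⟨p, hp, q, hq, r, hr, h1, h2, h3⟩
    have hc : StrictMonoOn (Nat.cast : ℕ → ℝ) Set.univ := Nat.strictMono_cast.strictMonoOn _
    have key (p q : ℕ × ℕ) : between (p.1 : ℝ) p.2 q.1 q.2 = between p.1 p.2 q.1 q.2 :=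
      between_map hc trivial trivial trivial trivial
    refine ⟨⟨p.1, p.2, Nat.cast_lt.2 (mem_pairs.1 hp).1⟩,
      ⟨q.1, q.2, Nat.cast_lt.2 (mem_pairs.1 hq).1⟩, ⟨r.1, r.2, Nat.cast_lt.2 (mem_pairs.1 hr).1⟩,
      (key p q).trans h1, (key q r).trans h2, (key p r).trans h3⟩
  · rintro ⟨x, y, z, h1, h2, h3⟩
    obtain ⟨g, hg, hlt⟩ := exists_strictMonoOn_rank {x.lo, x.hi, y.lo, y.hi, z.lo, z.hi}
    have hlt {t} (ht : t ∈ ({x.lo, x.hi, y.lo, y.hi, z.lo, z.hi} : Finset ℝ)) : g t < 6 :=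
      (hlt t ht).trans_le Finset.card_le_six
    have e1 : x.lo ∈ ({x.lo, x.hi, y.lo, y.hi, z.lo, z.hi} : Finset ℝ) := by simp
    have e2 : x.hi ∈ ({x.lo, x.hi, y.lo, y.hi, z.lo, z.hi} : Finset ℝ) := by simp
    have e3 : y.lo ∈ ({x.lo, x.hi, y.lo, y.hi, z.lo, z.hi} : Finset ℝ) := by simp
    have e4 : y.hi ∈ ({x.lo, x.hi, y.lo, y.hi, z.lo, z.hi} : Finset ℝ) := by simp
    have e5 : z.lo ∈ ({x.lo, x.hi, y.lo, y.hi, z.lo, z.hi} : Finset ℝ) := by simp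
    have e6 : z.hi ∈ ({x.lo, x.hi, y.lo, y.hi, z.lo, z.hi} : Finset ℝ) := by simp
    refine ⟨(g x.lo, g x.hi), mem_pairs.2 ⟨hg e1 e2 x.lo_lt_hi, hlt e2⟩, (g y.lo, g y.hi),
      mem_pairs.2 ⟨hg e3 e4 y.lo_lt_hi, hlt e4⟩, (g z.lo, g z.hi),
      mem_pairs.2 ⟨hg e5 e6 z.lo_lt_hi, hlt e6⟩, ?_, ?_, ?_⟩
    · exact (between_map hg e1 e2 e3 e4).trans h1
    · exact (between_map hg e3 e4 e5 e6).trans h2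
    · exact (between_map hg e1 e2 e5 e6).trans h3

/-- The atom table of the Interval Algebra. -/
def table : AtomTable Allen where
  tri := Tri
  conv := conv
  one := eq
  conv_conv := conv_conv
  tri_left {α β γ} := by
    rw [tri_iff, tri_iff]
    rintro ⟨x, y, z, rfl, rfl, rfl⟩
    exact ⟨y, x, z, of_swap .., rfl, rfl⟩
  tri_right {α β γ} := by
    rw [tri_iff, tri_iff]
    rintro ⟨x, y, z, rfl, rfl, rfl⟩
    exact ⟨x, z, y, rfl, of_swap .., rfl⟩
  tri_one {α γ} := by
    revert α γ
    decide +kernel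
  exists_tri := by decide +kernel
  exists_tri_all := by decide +kernel

theorem rel_eq_pull (a : Allen) : a.rel = pull of {a} := by
  ext ⟨x, y⟩
  exact of_eq_iff.symm

end Allen

open Allen in
theorem presents_IA : Presents table of IA where
  mem_iff R := by
    rw [← mem_closure_range_pull, IA]
    simp only [← rel_eq_pull]
  idx_swap := of_swap
  tri_iff := tri_iff

/-! ### Sets of basic interval relations as bit masks -/

namespace Allen

/-- The set of basic interval relations with a given bit mask. -/
def ofMask (n : ℕ) : Set Allen := {θ | n.testBit θ.idx = true}

/-- The bitwise disjunction of a family of bit masks. -/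
def orAll (g : Allen → ℕ) : ℕ :=
  g b ||| (g m ||| (g o ||| (g s ||| (g d ||| (g f ||| (g eq ||| (g fi ||| (g di ||| (g si |||
    (g oi ||| (g mi ||| g bi)))))))))))

/-- Weak composition of bit masks. -/
def maskComp (n k : ℕ) : ℕ :=
  orAll fun α => bif n.testBit α.idx then
    (orAll fun β => bif k.testBit β.idx then α.row >>> (13 * β.idx) % 8192 else 0) else 0

/-- Converse of bit masks. -/
def maskConv (n : ℕ) : ℕ :=
  orAll fun α => bif n.testBit α.idx then 2 ^ α.conv.idx else 0

theorem mem_ofMask {n : ℕ} {θ : Allen} : θ ∈ ofMask n ↔ n.testBit θ.idx = true := Iff.rfl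

theorem testBit_orAll {g : Allen → ℕ} {i : ℕ} :
    (orAll g).testBit i = true ↔ ∃ θ, (g θ).testBit i = true := by
  simp only [orAll, Nat.testBit_or, Bool.or_eq_true]
  constructor
  · rintro (h | h | h | h | h | h | h | h | h | h | h | h | h) <;> exact ⟨_, h⟩
  · rintro ⟨θ, h⟩
    cases θ <;> simp only [h, true_or, or_true]

theorem ofMask_inter (n k : ℕ) : ofMask (n &&& k) = ofMask n ∩ ofMask k := by
  ext θ
  simp [mem_ofMask, Nat.testBit_and]

theorem ofMask_two_pow (θ : Allen) : ofMask (2 ^ θ.idx) = {θ} := by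
  ext α
  rw [mem_ofMask, Nat.testBit_two_pow, decide_eq_true_iff, idx_injective.eq_iff,
    Set.mem_singleton_iff, eq_comm]

theorem testBit_cond {t : Bool} {n i : ℕ} :
    (bif t then n else 0).testBit i = true ↔ t = true ∧ n.testBit i = true := by
  cases t <;> simp

theorem ofMask_maskComp (n k : ℕ) :
    ofMask (maskComp n k) = table.comp (ofMask n) (ofMask k) := by
  ext γ
  simp only [mem_ofMask, maskComp, testBit_orAll, testBit_cond]
  -- Each block of a row has 13 bits, so shifting by `13 * β.idx` and reducing modulo `2 ^ 13`
  -- isolates the composition of `α` and `β`.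
  have h8 : 8192 = 2 ^ 13 := rfl
  simp only [h8, Nat.testBit_mod_two_pow, Nat.testBit_shiftRight, γ.idx_lt, decide_true,
    Bool.true_and]
  constructor
  · rintro ⟨α, hα, β, hβ, h⟩
    exact ⟨α, hα, β, hβ, h⟩
  · rintro ⟨α, hα, β, hβ, h⟩
    exact ⟨α, hα, β, hβ, h⟩

theorem ofMask_maskConv (n : ℕ) : ofMask (maskConv n) = table.inv (ofMask n) := by
  ext γ
  simp only [mem_ofMask, maskConv, testBit_orAll, testBit_cond, Nat.testBit_two_pow,
    decide_eq_true_iff, idx_injective.eq_iff]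
  constructor
  · rintro ⟨α, hα, rfl⟩
    change n.testBit α.conv.conv.idx = true
    rwa [conv_conv]
  · exact fun h => ⟨γ.conv, h, conv_conv γ⟩

theorem exists_eq_ofMask (A : Set Allen) : ∃ n < 8192, A = ofMask n := by
  classical
  refine ⟨orAll (fun α => bif decide (α ∈ A) then 2 ^ α.idx else 0),
    Nat.lt_pow_two_of_testBit (n := 13) _ fun i hi => ?_, ?_⟩
  · rw [← Bool.not_eq_true, testBit_orAll]
    rintro ⟨θ, h⟩
    rw [testBit_cond, Nat.testBit_two_pow, decide_eq_true_iff (p := _ = i)] at h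
    have := θ.idx_lt
    omega
  · ext θ
    simp only [mem_ofMask, testBit_orAll, testBit_cond, Nat.testBit_two_pow, decide_eq_true_iff,
      idx_injective.eq_iff]
    simp

theorem ofMask_nonempty_of_ne_zero {n : ℕ} (hn : n < 8192) (h0 : n ≠ 0) : (ofMask n).Nonempty := by
  obtain ⟨i, hi⟩ := Nat.exists_testBit_of_ne_zero h0
  have h13 : i < 13 := by
    by_contra hlt
    rw [Nat.testBit_lt_two_pow (hn.trans_le (Nat.pow_le_pow_right (n := 2) two_pos
      (not_lt.1 hlt)))] at hi
    simp at hi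
  obtain ⟨θ, rfl⟩ := exists_idx_eq h13
  exact ⟨θ, hi⟩

theorem ne_zero_of_ofMask_nonempty {n : ℕ} (h : (ofMask n).Nonempty) : n ≠ 0 := by
  rintro rfl
  obtain ⟨θ, hθ⟩ := h
  simp [mem_ofMask] at hθ

/-! ### The Helly test on masks and its reduction to generators. -/

/-- The Helly condition for three bit masks. -/
def maskHelly (n k l : ℕ) : Bool :=
  Nat.beq (n &&& k) 0 || Nat.beq (n &&& l) 0 || Nat.beq (k &&& l) 0 ||
    !Nat.beq (n &&& (k &&& l)) 0

theorem maskHelly_iff {n k l : ℕ} (hn : n < 8192) (hk : k < 8192) : maskHelly n k l = true ↔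
    ((ofMask n ∩ ofMask k).Nonempty → (ofMask n ∩ ofMask l).Nonempty →
      (ofMask k ∩ ofMask l).Nonempty → (ofMask n ∩ (ofMask k ∩ ofMask l)).Nonempty) := by
  simp only [← ofMask_inter]
  have key (i j : ℕ) (hi : i < 8192) : (ofMask (i &&& j)).Nonempty ↔ i &&& j ≠ 0 :=
    ⟨ne_zero_of_ofMask_nonempty, ofMask_nonempty_of_ne_zero (Nat.and_le_left.trans_lt hi)⟩
  rw [key _ _ hn, key _ _ hn, key _ _ hk, key _ _ hn]
  simp only [maskHelly, Bool.or_eq_true, Bool.not_eq_true', ← Bool.not_eq_true, Nat.beq_eq]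
  tauto

/-- The conditions under which the masks in `L`, which are intersections of masks in `G`, form a
distributive subalgebra. -/
def isClosed (L G : List ℕ) : Bool :=
  L.all fun n => Nat.blt n 8192 && (ofBits L).testBit (maskConv n) &&
    (L.all fun k => (ofBits L).testBit (n &&& k) && (ofBits L).testBit (maskComp n k)) &&
    G.all fun g => G.all fun g' => maskHelly n g g'

/-- The check tests Helly only for triples with two generators. As `L` is closed under intersection
and its members are intersections of four generators, these can be peeled off one at a time, first
from the second set of the triple and then from the third. -/
theorem isDistributive_of_isClosed {L G : List ℕ} (h1 : ∀ θ : Allen, 2 ^ θ.idx ∈ L)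
    (hGL : ∀ g ∈ G, g ∈ L)
    (hG : ∀ n ∈ L, ∃ g₁ ∈ G, ∃ g₂ ∈ G, ∃ g₃ ∈ G, ∃ g₄ ∈ G, n = g₁ &&& (g₂ &&& (g₃ &&& g₄)))
    (hL : isClosed L G = true) : table.IsDistributive {A | ∃ n ∈ L, A = ofMask n} := by
  simp only [isClosed, List.all_eq_true, Bool.and_eq_true, testBit_ofBits, Nat.blt_eq] at hL
  have hlt n (hn : n ∈ L) : n < 8192 := (hL n hn).1.1.1
  have hinter n (hn : n ∈ L) k (hk : k ∈ L) : n &&& k ∈ L := ((hL n hn).1.2 k hk).1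
  -- The Helly property is extended from generators to intersections of generators.
  have H2 n (hn : n ∈ L) g (hg : g ∈ G) g' (hg' : g' ∈ G) :=
    (maskHelly_iff (hlt n hn) (hlt g (hGL g hg))).1 ((hL n hn).2 g hg g' hg')
  have H1step (k g' : ℕ) (hk : k ∈ L) (hg' : g' ∈ G)
      (ih : ∀ n ∈ L, ∀ g ∈ G, (ofMask n ∩ ofMask k).Nonempty → (ofMask n ∩ ofMask g).Nonempty →
        (ofMask k ∩ ofMask g).Nonempty → (ofMask n ∩ (ofMask k ∩ ofMask g)).Nonempty) :
      ∀ n ∈ L, ∀ g ∈ G, (ofMask n ∩ ofMask (g' &&& k)).Nonempty →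
        (ofMask n ∩ ofMask g).Nonempty → (ofMask (g' &&& k) ∩ ofMask g).Nonempty →
        (ofMask n ∩ (ofMask (g' &&& k) ∩ ofMask g)).Nonempty := by
    intro n hn g hg hnk hng hkg
    rw [ofMask_inter] at *
    -- The case of two generators is applied to `n ∩ k`, `g'`, `g`; that `n ∩ k` meets `g` is the
    -- induction hypothesis.
    have := H2 _ (hinter n hn k hk) g' hg' g hg
    rw [ofMask_inter] at this
    refine (this ?_ ?_ ?_).mono fun x hx => ⟨hx.1.1, ⟨hx.2.1, hx.1.2⟩, hx.2.2⟩
    · exact hnk.mono fun x hx => ⟨⟨hx.1, hx.2.2⟩, hx.2.1⟩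
    · exact (ih n hn g hg (hnk.mono fun x hx => ⟨hx.1, hx.2.2⟩) hng
        (hkg.mono fun x hx => ⟨hx.1.2, hx.2⟩)).mono fun x hx => ⟨⟨hx.1, hx.2.1⟩, hx.2.2⟩
    · exact hkg.mono fun x hx => ⟨hx.1.1, hx.2⟩
  have H1 k (hk : k ∈ L) : ∀ n ∈ L, ∀ g ∈ G, (ofMask n ∩ ofMask k).Nonempty →
      (ofMask n ∩ ofMask g).Nonempty → (ofMask k ∩ ofMask g).Nonempty →
      (ofMask n ∩ (ofMask k ∩ ofMask g)).Nonempty := by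
    obtain ⟨g₁, h₁, g₂, h₂, g₃, h₃, g₄, h₄, rfl⟩ := hG k hk
    have i₄ := hGL _ h₄
    have i₃ := hinter _ (hGL _ h₃) _ i₄
    have i₂ := hinter _ (hGL _ h₂) _ i₃
    exact H1step _ _ i₂ h₁ <| H1step _ _ i₃ h₂ <| H1step _ _ i₄ h₃ fun n hn g hg =>
      H2 n hn _ h₄ g hg
  have Hstep (l g : ℕ) (hg : g ∈ G)
      (ih : ∀ n ∈ L, ∀ k ∈ L, (ofMask n ∩ ofMask k).Nonempty → (ofMask n ∩ ofMask l).Nonempty →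
        (ofMask k ∩ ofMask l).Nonempty → (ofMask n ∩ (ofMask k ∩ ofMask l)).Nonempty) :
      ∀ n ∈ L, ∀ k ∈ L, (ofMask n ∩ ofMask k).Nonempty → (ofMask n ∩ ofMask (g &&& l)).Nonempty →
        (ofMask k ∩ ofMask (g &&& l)).Nonempty →
        (ofMask n ∩ (ofMask k ∩ ofMask (g &&& l))).Nonempty := by
    intro n hn k hk hnk hnl hkl
    -- The generator `g` is moved from the third set into the first; that `n ∩ g` still meets `k` is
    -- `H1`.
    have := ih _ (hinter n hn g (hGL g hg)) k hk
    rw [ofMask_inter] at *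
    refine (this ?_ ?_ ?_).mono fun x hx => ⟨hx.1.1, hx.2.1, hx.1.2, hx.2.2⟩
    · exact (H1 k hk n hn g hg hnk (hnl.mono fun x hx => ⟨hx.1, hx.2.1⟩)
        (hkl.mono fun x hx => ⟨hx.1, hx.2.1⟩)).mono fun x hx => ⟨⟨hx.1, hx.2.2⟩, hx.2.1⟩
    · exact hnl.mono fun x hx => ⟨⟨hx.1, hx.2.1⟩, hx.2.2⟩
    · exact hkl.mono fun x hx => ⟨hx.1, hx.2.2⟩
  have H l (hl : l ∈ L) : ∀ n ∈ L, ∀ k ∈ L, (ofMask n ∩ ofMask k).Nonempty →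
      (ofMask n ∩ ofMask l).Nonempty → (ofMask k ∩ ofMask l).Nonempty →
      (ofMask n ∩ (ofMask k ∩ ofMask l)).Nonempty := by
    obtain ⟨g₁, h₁, g₂, h₂, g₃, h₃, g₄, h₄, rfl⟩ := hG l hl
    exact Hstep _ _ h₁ <| Hstep _ _ h₂ <| Hstep _ _ h₃ fun n hn k hk => H1 k hk n hn _ h₄
  refine .of_helly (fun θ => ⟨_, h1 θ, (ofMask_two_pow θ).symm⟩) ?_ ?_ ?_ ?_
  · rintro _ ⟨n, hn, rfl⟩
    exact ⟨_, (hL n hn).1.1.2, (ofMask_maskConv n).symm⟩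
  · rintro _ ⟨n, hn, rfl⟩ _ ⟨k, hk, rfl⟩
    exact ⟨_, ((hL n hn).1.2 k hk).2, (ofMask_maskComp n k).symm⟩
  · rintro _ ⟨n, hn, rfl⟩ _ ⟨k, hk, rfl⟩
    exact ⟨_, hinter n hn k hk, (ofMask_inter n k).symm⟩
  · rintro _ ⟨n, hn, rfl⟩ _ ⟨k, hk, rfl⟩ _ ⟨l, hl, rfl⟩
    exact H l hl n hn k hk

end Allen

/-! ### Classification of the distributive subalgebras of the Interval Algebra -/

namespace Allen

/-- The masks of the convex relations and of the empty relation. -/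
def convexMasks : List ℕ := [
  0, 1, 2, 3, 4, 6, 7, 8, 12, 14, 15, 16, 24, 28, 30, 31, 32, 48, 64, 72, 96, 120, 128, 132, 134,
  135, 192, 204, 206, 207, 224, 252, 254, 255, 256, 384, 388, 390, 391, 512, 576, 584, 768, 960,
  972, 974, 975, 1024, 1056, 1072, 1536, 1632, 1656, 1792, 2016, 2044, 2046, 2047, 2048, 3072,
  3104, 3120, 3584, 3680, 3704, 3840, 4064, 4092, 4094, 4095, 4096, 6144, 7168, 7200, 7216, 7680,
  7776, 7800, 7936, 8160, 8188, 8190, 8191]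

/-- The masks of the relations in `sIA`. -/
def sMasks : List ℕ := [
  0, 1, 2, 4, 5, 7, 8, 16, 20, 21, 23, 28, 29, 31, 32, 64, 128, 160, 224, 256, 260, 261, 263,
  388, 389, 391, 512, 520, 584, 1024, 1040, 1072, 1280, 1300, 1301, 1303, 1460, 1461, 1463, 1792,
  1820, 1821, 1823, 2044, 2045, 2047, 2048, 4096, 5120, 5136, 5168, 5376, 5396, 5397, 5399, 5556,
  5557, 5559, 5888, 5916, 5917, 5919, 6140, 6141, 6143, 7168, 7184, 7216, 7424, 7444, 7445, 7447,
  7604, 7605, 7607, 7936, 7964, 7965, 7967, 8188, 8189, 8191]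

/-- The mask of the set of upper bounds of a basic relation in the neighbourhood order. -/
def up : Allen → ℕ
  | b => 8191 | m => 8190 | o => 8188 | s => 7800 | d => 7216 | f => 7200 | eq => 7776
  | fi => 8160 | di => 7936 | si => 7680 | oi => 7168 | mi => 6144 | bi => 4096

/-- The mask of the set of lower bounds of a basic relation in the neighbourhood order. -/
def down : Allen → ℕ
  | b => 1 | m => 3 | o => 7 | s => 15 | d => 31 | f => 255 | eq => 207 | fi => 135 | di => 391
  | si => 975 | oi => 2047 | mi => 4095 | bi => 8191

/-- All basic interval relations. -/
def all : List Allen := [b, m, o, s, d, f, eq, fi, di, si, oi, mi, bi]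

theorem mem_all (θ : Allen) : θ ∈ all := by cases θ <;> decide

/-- The masks of the intersections of an upper and a lower set. -/
def convexProducts : List ℕ := all.flatMap fun α => all.map fun β => up α &&& down β

/-- The masks of the five relations of `sPA` between two lower endpoints. -/
def loLo : List ℕ := [391, 7216, 584, 7607, 8191]

/-- The masks of the five relations of `sPA` between a lower and an upper endpoint. -/
def loHi : List ℕ := [2047, 4096, 2048, 6143, 8191]

/-- The masks of the five relations of `sPA` between an upper and a lower endpoint. -/
def hiLo : List ℕ := [1, 8188, 2, 8189, 8191]

/-- The masks of the five relations of `sPA` between two upper endpoints. -/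
def hiHi : List ℕ := [31, 7936, 224, 7967, 8191]

/-- The masks of the conjunctions of four endpoint constraints. -/
def sProducts : List ℕ := loLo.flatMap fun i => loHi.flatMap fun j => hiLo.flatMap fun k =>
  hiHi.map fun l => i &&& (j &&& (k &&& l))

/-- Since `ofBits` ignores order and repetition, comparing two numbers decides whether two lists
have the same members. -/
theorem mem_iff_of_ofBits_eq {L L' : List ℕ} (h : ofBits L = ofBits L') {n : ℕ} :
    n ∈ L ↔ n ∈ L' := by
  rw [← testBit_ofBits, h, testBit_ofBits]

theorem mem_convexMasks {n : ℕ} : n ∈ convexMasks ↔ ∃ α β, n = up α &&& down β := by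
  rw [mem_iff_of_ofBits_eq (show ofBits convexMasks = ofBits convexProducts by decide +kernel)]
  simp [convexProducts, mem_all, eq_comm]

theorem mem_sMasks {n : ℕ} : n ∈ sMasks ↔
    ∃ i ∈ loLo, ∃ j ∈ loHi, ∃ k ∈ hiLo, ∃ l ∈ hiHi, n = i &&& (j &&& (k &&& l)) := by
  rw [mem_iff_of_ofBits_eq (show ofBits sMasks = ofBits sProducts by decide +kernel)]
  simp only [sProducts, List.mem_flatMap, List.mem_map, eq_comm]

/-- The convex classes of basic relations, together with the empty class. -/
def convexClass : Set (Set Allen) := {A | ∃ n ∈ convexMasks, A = ofMask n}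

/-- The classes of basic relations that belong to the members of `sIA`. -/
def sClass : Set (Set Allen) := {A | ∃ n ∈ sMasks, A = ofMask n}

theorem isDistributive_convexClass : table.IsDistributive convexClass := by
  refine isDistributive_of_isClosed (G := all.map up ++ all.map down) (by decide +kernel)
    (by decide +kernel) (fun n hn => ?_) (by decide +kernel)
  obtain ⟨α, β, rfl⟩ := mem_convexMasks.1 hn
  have hα : up α ∈ all.map up ++ all.map down :=
    List.mem_append_left _ (List.mem_map_of_mem (mem_all α))
  have hβ : down β ∈ all.map up ++ all.map down :=
    List.mem_append_right _ (List.mem_map_of_mem (mem_all β))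
  -- A convex set needs only two generators; the second is repeated to fill the four places.
  exact ⟨_, hα, _, hβ, _, hβ, _, hβ, by simp⟩

theorem isDistributive_sClass : table.IsDistributive sClass := by
  refine isDistributive_of_isClosed (G := loLo ++ loHi ++ hiLo ++ hiHi) (by decide +kernel)
    (by decide +kernel) (fun n hn => ?_) (by decide +kernel)
  obtain ⟨i, hi, j, hj, k, hk, l, hl, rfl⟩ := mem_sMasks.1 hn
  exact ⟨i, by simp [hi], j, by simp [hj], k, by simp [hk], l, by simp [hl], rfl⟩

/-! ### Exhaustive test of the 8192 sets of atoms. -/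

/-- Pairs of intersecting weak compositions of basic relations. -/
def testPairs : List (ℕ × ℕ) := [(31, 7216), (28, 391), (1072, 7936), (391, 7936), (31, 584),
  (584, 7936), (224, 7216), (224, 388), (224, 584), (7, 388), (1792, 7168)]

/-- A mask that is obtained from `n` (or its converse, if `t` is `true`) by composing with `α` on
the left and with `β` on the right and then intersecting with `b ∪ m ∪ o`. -/
def probe (t : Bool) (α β : Allen) (n : ℕ) : ℕ :=
  maskComp (maskComp (2 ^ α.idx) (bif t then maskConv n else n)) (2 ^ β.idx) &&& 7

/-- Whether `p` holds for all numbers with `k` further binary digits after the digits of `n`. -/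
def allBits (p : ℕ → Bool) : ℕ → ℕ → Bool
  | 0, n => p n
  | k + 1, n => allBits p k (2 * n) && allBits p k (2 * n + 1)

/-- The numbers with leading digits `n` and `k` further digits form an interval, halved at each
step; depth 13 from `n = 0` covers all masks. -/
theorem of_allBits {p : ℕ → Bool} {k n : ℕ} (h : allBits p k n = true) {i : ℕ}
    (h1 : 2 ^ k * n ≤ i) (h2 : i < 2 ^ k * (n + 1)) : p i = true := by
  induction k generalizing n with
  | zero =>
    obtain rfl : i = n := by omega
    exact h
  | succ k ih =>
    rw [allBits, Bool.and_eq_true] at h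
    rw [pow_succ] at h1 h2
    by_cases hi : i < 2 ^ k * (2 * n + 1)
    · exact ih h.1 (by linarith) hi
    · exact ih h.2 (by linarith) (by linarith)

/-- A mask that passes the Helly test is in `L` or one of its probes is `r`. -/
def dichotomy (L : List ℕ) (r : ℕ) (n : ℕ) : Bool :=
  (testPairs.any fun p => !maskHelly n p.1 p.2) || (ofBits L).testBit n ||
    ([m, f].any fun α => [m, s].any fun β => [true, false].any fun t =>
      Nat.beq (probe t α β n) r)

/-- Compositions of two atoms belong to every subalgebra, so a set that fails the Helly test with
one of these pairs lies in no distributive subalgebra. -/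
theorem testPairs_comp : ∀ p ∈ testPairs,
    (∃ α β : Allen, p.1 = maskComp (2 ^ α.idx) (2 ^ β.idx)) ∧
    (∃ α β : Allen, p.2 = maskComp (2 ^ α.idx) (2 ^ β.idx)) ∧ p.1 < 8192 ∧ p.1 &&& p.2 ≠ 0 := by
  decide +kernel

/-- Mask 5 is `{b, o}`, a nonconvex set generated by every nonconvex set that passes the Helly
tests. In `dichotomy_sMasks` the same role is played by mask 3, which is `{b, m}`. -/
theorem dichotomy_convexMasks : allBits (dichotomy convexMasks 5) 13 0 = true := by
  decide +kernel

theorem dichotomy_sMasks : allBits (dichotomy sMasks 3) 13 0 = true := by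
  decide +kernel

variable {𝒜 : Set (Set Allen)}

theorem ofMask_comp_mem (h : table.IsDistributive 𝒜) (α β : Allen) :
    ofMask (maskComp (2 ^ α.idx) (2 ^ β.idx)) ∈ 𝒜 := by
  rw [ofMask_maskComp, ofMask_two_pow, ofMask_two_pow]
  exact h.comp _ (h.singleton α) _ (h.singleton β)

theorem ofMask_probe_mem (h : table.IsDistributive 𝒜) (t : Bool) (α β : Allen) {n : ℕ}
    (hn : ofMask n ∈ 𝒜) : ofMask (probe t α β n) ∈ 𝒜 := by
  have h7 : ofMask 7 ∈ 𝒜 := by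
    rw [show 7 = maskComp (2 ^ idx o) (2 ^ idx o) by decide +kernel]
    exact ofMask_comp_mem h _ _
  rw [probe, ofMask_inter, ofMask_maskComp, ofMask_maskComp, ofMask_two_pow, ofMask_two_pow]
  refine h.inter _ (h.comp _ (h.comp _ (h.singleton α) _ ?_) _ (h.singleton β)) _ h7
  cases t
  · exact hn
  · rw [cond_true, ofMask_maskConv]
    exact h.inv _ hn

theorem ofMask_mem_of_dichotomy (h : table.IsDistributive 𝒜) {L : List ℕ} {r : ℕ}
    (hL : allBits (dichotomy L r) 13 0 = true) (hA : ¬ 𝒜 ⊆ {A | ∃ n ∈ L, A = ofMask n}) :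
    ofMask r ∈ 𝒜 := by
  obtain ⟨A, hA, hAL⟩ := Set.not_subset.1 hA
  obtain ⟨n, hn, rfl⟩ := exists_eq_ofMask A
  have hd := of_allBits hL (i := n) (by omega) (by omega)
  simp only [dichotomy, Bool.or_eq_true, List.any_eq_true, testBit_ofBits, Nat.beq_eq] at hd
  rcases hd with (⟨p, hp, hd⟩ | hd) | ⟨α, -, β, -, t, -, rfl⟩
  · obtain ⟨⟨α, β, h1⟩, ⟨α', β', h2⟩, hlt, h0⟩ := testPairs_comp p hp
    rw [Bool.not_eq_true', ← Bool.not_eq_true, maskHelly_iff hn hlt] at hd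
    refine absurd (fun ha hb hc => h.helly hA ?_ ?_ ha hb hc) hd
    · exact h1 ▸ ofMask_comp_mem h α β
    · exact h2 ▸ ofMask_comp_mem h α' β'
  · exact absurd ⟨n, hd, rfl⟩ hAL
  · exact ofMask_probe_mem h t α β hA

/-- Every distributive subalgebra consists of convex relations or is contained in `sClass`. -/
theorem subset_convexClass_or_subset_sClass (h : table.IsDistributive 𝒜) :
    𝒜 ⊆ convexClass ∨ 𝒜 ⊆ sClass := by
  by_contra! hne
  have h5 := ofMask_mem_of_dichotomy h dichotomy_convexMasks hne.1
  have h3 := ofMask_mem_of_dichotomy h dichotomy_sMasks hne.2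
  have h6 := ofMask_probe_mem h true m m h3
  rw [show probe true m m 3 = 6 by decide +kernel] at h6
  -- The masks 5, 3 and 6 are `{b, o}`, `{b, m}` and `{m, o}`: any two share an atom, but no atom
  -- lies in all three.
  obtain ⟨θ, hθ⟩ := h.helly h5 h3 h6 ⟨b, rfl, rfl⟩ ⟨o, rfl, rfl⟩ ⟨m, rfl, rfl⟩
  rw [← ofMask_inter, ← ofMask_inter] at hθ
  simp [mem_ofMask] at hθ

theorem ofMask_injOn : Set.InjOn ofMask {n | n < 8192} := by
  intro n hn k hk e
  refine Nat.eq_of_testBit_eq fun i => ?_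
  by_cases hi : i < 13
  · obtain ⟨θ, rfl⟩ := exists_idx_eq hi
    exact Bool.eq_iff_iff.2 (Set.ext_iff.1 e θ)
  · have h13 : 8192 ≤ 2 ^ i := Nat.pow_le_pow_right (n := 2) (i := 13) two_pos (not_lt.1 hi)
    rw [Nat.testBit_lt_two_pow (lt_of_lt_of_le hn h13),
      Nat.testBit_lt_two_pow (lt_of_lt_of_le hk h13)]

theorem not_subset_of_mem {L L' : List ℕ} (n : ℕ) (hn : n ∈ L) (hn' : n ∉ L') (hlt : n < 8192)
    (hL' : ∀ k ∈ L', k < 8192) :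
    ¬ ({A | ∃ n ∈ L, A = ofMask n} : Set (Set Allen)) ⊆ {A | ∃ n ∈ L', A = ofMask n} := by
  intro h
  obtain ⟨k, hk, e⟩ := h ⟨n, hn, rfl⟩
  exact hn' (ofMask_injOn hlt (hL' k hk) e ▸ hk)

/-- The witness is `{b, m}`, that is `x.hi ≤ y.lo`; the relation `≤` is missing from `sPA`. -/
theorem not_convexClass_subset_sClass : ¬ convexClass ⊆ sClass :=
  not_subset_of_mem 3 (by decide) (by decide) (by decide) (by decide)

/-- The witness is `{b, o}`, cut out of the convex set `{b, m, o}` by `x.hi ≠ y.lo`. -/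
theorem not_sClass_subset_convexClass : ¬ sClass ⊆ convexClass :=
  not_subset_of_mem 5 (by decide) (by decide) (by decide) (by decide)

/-! ### The classes `convexIA` and `sIA` -/

/-- The sum of the positions of the two endpoints. -/
def height : Allen → ℕ
  | b => 0 | m => 1 | o => 2 | s => 3 | d => 4 | f => 5 | eq => 4 | fi => 3 | di => 4 | si => 5
  | oi => 6 | mi => 7 | bi => 8

/-- The upper neighbours of a basic relation. -/
def neighbours : Allen → List Allen
  | b => [m] | m => [o] | o => [s, fi] | s => [d, eq] | d => [f] | f => [oi] | eq => [f, si]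
  | fi => [eq, di] | di => [si] | si => [oi] | oi => [mi] | mi => [bi] | bi => []

theorem neighbour_iff {α β : Allen} : Neighbour α β ↔ β ∈ neighbours α := by
  constructor
  · rintro (_ | _) <;> decide
  · cases α <;> simp only [neighbours, List.mem_cons, List.not_mem_nil, or_false]
    all_goals rintro (rfl | rfl) <;> constructor

/-- The set `up α` is closed under passing to upper neighbours. Conversely, if `β ≠ α` lies in it,
some upper neighbour of `α` still has `β` in its upper set, and `height` increases, so the climb
ends. -/
theorem prec_iff {α β : Allen} : α.Prec β ↔ (up α).testBit β.idx = true := by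
  constructor
  · intro h
    induction h with
    | refl =>
      revert α
      decide
    | @tail β γ _ h ih =>
      have key : ∀ α β : Allen, (up α).testBit β.idx = true → ∀ γ ∈ neighbours β,
          (up α).testBit γ.idx = true := by
        decide +kernel
      exact key α β ih γ (neighbour_iff.1 h)
  · intro h
    have key : ∀ α β, (up α).testBit β.idx = true → α = β ∨
        ∃ γ ∈ neighbours α, (up γ).testBit β.idx = true ∧ height α < height γ := by
      decide +kernel
    have hle : ∀ α, height α ≤ 8 := by decide
    induction hk : 8 - height α using Nat.strong_induction_on generalizing α with
    | _ k ih =>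
      rcases key α β h with rfl | ⟨γ, hγ, h', hlt⟩
      · exact .refl
      · exact .head (neighbour_iff.2 hγ) (ih (8 - height γ) (by have := hle γ; omega) h' rfl)

theorem setOf_prec_prec (α β : Allen) :
    {θ : Allen | α.Prec θ ∧ θ.Prec β} = ofMask (up α &&& down β) := by
  have key : ∀ θ β : Allen, (up θ).testBit β.idx = true ↔ (down β).testBit θ.idx = true := by
    decide +kernel
  ext θ
  simp only [Set.mem_ofPred_eq, prec_iff, ofMask_inter, Set.mem_inter_iff, mem_ofMask, key θ β]

theorem convexRel_eq (α β : Allen) : convexRel α β = pull of (ofMask (up α &&& down β)) := by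
  rw [← setOf_prec_prec]
  ext ⟨x, y⟩
  simp only [convexRel, Set.mem_iUnion, exists_prop]
  constructor
  · rintro ⟨θ, hθ, h⟩
    rw [rel_eq_pull] at h
    change of x y = θ at h
    subst h
    exact hθ
  · exact fun h => ⟨of x y, h, of_eq_iff.1 rfl⟩

theorem convexIA_eq : convexIA = pull of '' convexClass := by
  ext R
  constructor
  · rintro (rfl | ⟨α, β, -, rfl⟩)
    · exact ⟨∅, ⟨0, by decide, by ext; simp [mem_ofMask]⟩, rfl⟩
    · exact ⟨_, ⟨_, mem_convexMasks.2 ⟨α, β, rfl⟩, rfl⟩, (convexRel_eq α β).symm⟩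
  · rintro ⟨_, ⟨n, hn, rfl⟩, rfl⟩
    obtain ⟨α, β, rfl⟩ := mem_convexMasks.1 hn
    rw [← convexRel_eq]
    by_cases h : α.Prec β
    · exact Or.inr ⟨α, β, h, rfl⟩
    -- By transitivity, an interval whose bounds are not in order is empty.
    · refine Or.inl (Set.eq_empty_of_forall_notMem fun p hp => h ?_)
      rw [convexRel_eq, ← setOf_prec_prec] at hp
      exact hp.1.trans hp.2

/-- The masks of the five relations of `sPA` between two given endpoints. -/
theorem endpoint_masks {u v : Interval → ℝ} {lt gt e ne : ℕ}
    (hlt : ∀ x y, u x < v y ↔ of x y ∈ ofMask lt) (hgt : ∀ x y, v y < u x ↔ of x y ∈ ofMask gt)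
    (he : ∀ θ, θ ∈ ofMask e ↔ θ ∉ ofMask lt ∧ θ ∉ ofMask gt)
    (hne : ∀ θ, θ ∈ ofMask ne ↔ θ ∈ ofMask lt ∨ θ ∈ ofMask gt) :
    (∀ P ∈ sPA, ∃ n ∈ [lt, gt, e, ne, 8191], ∀ x y, (u x, v y) ∈ P ↔ of x y ∈ ofMask n) ∧
    (∀ n ∈ [lt, gt, e, ne, 8191], ∃ P ∈ sPA, ∀ x y, (u x, v y) ∈ P ↔ of x y ∈ ofMask n) := by
  -- Only `<` and `>` need a comparison with the atoms; `=` and `≠` follow by trichotomy.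
  have he' x y : u x = v y ↔ of x y ∈ ofMask e := by
    rw [he, ← hlt, ← hgt, not_lt, not_lt, ← le_antisymm_iff, eq_comm]
  have hne' x y : u x ≠ v y ↔ of x y ∈ ofMask ne := by
    rw [hne, ← hlt, ← hgt, ne_iff_lt_or_gt]
  have hall : ∀ θ : Allen, θ ∈ ofMask 8191 := fun θ => by cases θ <;> rfl
  constructor
  · rintro P (rfl | rfl | rfl | rfl | rfl)
    · exact ⟨lt, by simp, hlt⟩
    · exact ⟨gt, by simp, hgt⟩
    · exact ⟨e, by simp, he'⟩
    · exact ⟨ne, by simp, hne'⟩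
    · exact ⟨8191, by simp, fun x y => iff_of_true trivial (hall _)⟩
  · intro n hn
    simp only [List.mem_cons, List.not_mem_nil, or_false] at hn
    rcases hn with rfl | rfl | rfl | rfl | rfl
    · exact ⟨_, Or.inl rfl, hlt⟩
    · exact ⟨_, Or.inr (Or.inl rfl), hgt⟩
    · exact ⟨_, Or.inr (Or.inr (Or.inl rfl)), he'⟩
    · exact ⟨_, Or.inr (Or.inr (Or.inr (Or.inl rfl))), hne'⟩
    · exact ⟨_, Or.inr (Or.inr (Or.inr (Or.inr rfl))), fun x y => iff_of_true trivial (hall _)⟩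

/-- To check which endpoint comparisons are implied, it is enough to go through the definitions
of the basic relations. -/
theorem lt_iff_mem_ofMask {x y : Interval} {t t' : ℝ} {n : ℕ}
    (h : ∀ θ : Allen, θ.Holds x y → (t < t' ↔ θ ∈ ofMask n)) : t < t' ↔ of x y ∈ ofMask n :=
  h _ (of_eq_iff.1 rfl)

theorem loLo_masks :
    (∀ P ∈ sPA, ∃ n ∈ loLo, ∀ x y : Interval, (x.lo, y.lo) ∈ P ↔ of x y ∈ ofMask n) ∧
    (∀ n ∈ loLo, ∃ P ∈ sPA, ∀ x y : Interval, (x.lo, y.lo) ∈ P ↔ of x y ∈ ofMask n) := by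
  refine endpoint_masks (u := Interval.lo) (v := Interval.lo) (fun x y => ?_) (fun x y => ?_)
    (by simp only [mem_ofMask]; decide) (by simp only [mem_ofMask]; decide) <;>
  · have := x.lo_lt_hi
    have := y.lo_lt_hi
    refine lt_iff_mem_ofMask fun θ h => ?_
    cases θ <;> simp [Holds, mem_ofMask, idx, Nat.testBit_eq_decide_div_mod_eq] at h ⊢ <;> grind

theorem loHi_masks :
    (∀ P ∈ sPA, ∃ n ∈ loHi, ∀ x y : Interval, (x.lo, y.hi) ∈ P ↔ of x y ∈ ofMask n) ∧
    (∀ n ∈ loHi, ∃ P ∈ sPA, ∀ x y : Interval, (x.lo, y.hi) ∈ P ↔ of x y ∈ ofMask n) := by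
  refine endpoint_masks (u := Interval.lo) (v := Interval.hi) (fun x y => ?_) (fun x y => ?_)
    (by simp only [mem_ofMask]; decide) (by simp only [mem_ofMask]; decide) <;>
  · have := x.lo_lt_hi
    have := y.lo_lt_hi
    refine lt_iff_mem_ofMask fun θ h => ?_
    cases θ <;> simp [Holds, mem_ofMask, idx, Nat.testBit_eq_decide_div_mod_eq] at h ⊢ <;> grind

theorem hiLo_masks :
    (∀ P ∈ sPA, ∃ n ∈ hiLo, ∀ x y : Interval, (x.hi, y.lo) ∈ P ↔ of x y ∈ ofMask n) ∧
    (∀ n ∈ hiLo, ∃ P ∈ sPA, ∀ x y : Interval, (x.hi, y.lo) ∈ P ↔ of x y ∈ ofMask n) := by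
  refine endpoint_masks (u := Interval.hi) (v := Interval.lo) (fun x y => ?_) (fun x y => ?_)
    (by simp only [mem_ofMask]; decide) (by simp only [mem_ofMask]; decide) <;>
  · have := x.lo_lt_hi
    have := y.lo_lt_hi
    refine lt_iff_mem_ofMask fun θ h => ?_
    cases θ <;> simp [Holds, mem_ofMask, idx, Nat.testBit_eq_decide_div_mod_eq] at h ⊢ <;> grind

theorem hiHi_masks :
    (∀ P ∈ sPA, ∃ n ∈ hiHi, ∀ x y : Interval, (x.hi, y.hi) ∈ P ↔ of x y ∈ ofMask n) ∧
    (∀ n ∈ hiHi, ∃ P ∈ sPA, ∀ x y : Interval, (x.hi, y.hi) ∈ P ↔ of x y ∈ ofMask n) := by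
  refine endpoint_masks (u := Interval.hi) (v := Interval.hi) (fun x y => ?_) (fun x y => ?_)
    (by simp only [mem_ofMask]; decide) (by simp only [mem_ofMask]; decide) <;>
  · have := x.lo_lt_hi
    have := y.lo_lt_hi
    refine lt_iff_mem_ofMask fun θ h => ?_
    cases θ <;> simp [Holds, mem_ofMask, idx, Nat.testBit_eq_decide_div_mod_eq] at h ⊢ <;> grind

theorem sIA_eq : sIA = pull of '' sClass := by
  have key {P₁ P₂ P₃ P₄ : SetRel ℝ ℝ} {i j k l : ℕ}
      (h₁ : ∀ x y : Interval, (x.lo, y.lo) ∈ P₁ ↔ of x y ∈ ofMask i)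
      (h₂ : ∀ x y : Interval, (x.lo, y.hi) ∈ P₂ ↔ of x y ∈ ofMask j)
      (h₃ : ∀ x y : Interval, (x.hi, y.lo) ∈ P₃ ↔ of x y ∈ ofMask k)
      (h₄ : ∀ x y : Interval, (x.hi, y.hi) ∈ P₄ ↔ of x y ∈ ofMask l) :
      pull of (ofMask (i &&& (j &&& (k &&& l)))) = {(x, y) | (x.lo, y.lo) ∈ P₁ ∧
        (x.lo, y.hi) ∈ P₂ ∧ (x.hi, y.lo) ∈ P₃ ∧ (x.hi, y.hi) ∈ P₄} := by
    ext ⟨x, y⟩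
    simp only [Set.mem_ofPred_eq, h₁, h₂, h₃, h₄, pull, ofMask_inter, Set.mem_inter_iff]
  ext R
  constructor
  · rintro ⟨P₁, h₁, P₂, h₂, P₃, h₃, P₄, h₄, rfl⟩
    obtain ⟨i, hi, h₁⟩ := loLo_masks.1 P₁ h₁
    obtain ⟨j, hj, h₂⟩ := loHi_masks.1 P₂ h₂
    obtain ⟨k, hk, h₃⟩ := hiLo_masks.1 P₃ h₃
    obtain ⟨l, hl, h₄⟩ := hiHi_masks.1 P₄ h₄
    exact ⟨_, ⟨_, mem_sMasks.2 ⟨i, hi, j, hj, k, hk, l, hl, rfl⟩, rfl⟩, key h₁ h₂ h₃ h₄⟩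
  · rintro ⟨_, ⟨n, hn, rfl⟩, rfl⟩
    obtain ⟨i, hi, j, hj, k, hk, l, hl, rfl⟩ := mem_sMasks.1 hn
    obtain ⟨P₁, hP₁, h₁⟩ := loLo_masks.2 i hi
    obtain ⟨P₂, hP₂, h₂⟩ := loHi_masks.2 j hj
    obtain ⟨P₃, hP₃, h₃⟩ := hiLo_masks.2 k hk
    obtain ⟨P₄, hP₄, h₄⟩ := hiHi_masks.2 l hl
    exact ⟨P₁, hP₁, P₂, hP₂, P₃, hP₃, P₄, hP₄, key h₁ h₂ h₃ h₄⟩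

end Allen

/-! ### The Rectangle Algebra -/

theorem Interval.isBounded_rectangle (I J : Interval) :
    Bornology.IsBounded (Set.Icc I.lo I.hi ×ˢ Set.Icc J.lo J.hi) :=
  (Metric.isBounded_Icc _ _).prod (Metric.isBounded_Icc _ _)

/-- The rectangle with given projections, as a bounded region. -/
def Region.rectangle (I J : Interval) : Region where
  carrier := Set.Icc I.lo I.hi ×ˢ Set.Icc J.lo J.hi
  nonempty := (Set.nonempty_Icc.2 I.lo_lt_hi.le).prod (Set.nonempty_Icc.2 J.lo_lt_hi.le)
  regularClosed := by
    rw [interior_prod_eq, closure_prod_eq, interior_Icc, interior_Icc,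
      closure_Ioo I.lo_lt_hi.ne, closure_Ioo J.lo_lt_hi.ne]
  bounded := I.isBounded_rectangle J

theorem Region.Ix_rectangle (I J : Interval) : (rectangle I J).Ix = I := by
  have h : Prod.fst '' (rectangle I J).carrier = Set.Icc I.lo I.hi :=
    Set.fst_image_prod _ (Set.nonempty_Icc.2 J.lo_lt_hi.le)
  ext
  · exact (congrArg sInf h).trans (csInf_Icc I.lo_lt_hi.le)
  · exact (congrArg sSup h).trans (csSup_Icc I.lo_lt_hi.le)

theorem Region.Iy_rectangle (I J : Interval) : (rectangle I J).Iy = J := by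
  have h : Prod.snd '' (rectangle I J).carrier = Set.Icc J.lo J.hi :=
    Set.snd_image_prod (Set.nonempty_Icc.2 I.lo_lt_hi.le) _
  ext
  · exact (congrArg sInf h).trans (csInf_Icc J.lo_lt_hi.le)
  · exact (congrArg sSup h).trans (csSup_Icc J.lo_lt_hi.le)

/-- The atom of the Rectangle Algebra that contains a given pair of regions. -/
noncomputable def Region.of (a a' : Region) : Allen × Allen :=
  (Allen.of a.Ix a'.Ix, Allen.of a.Iy a'.Iy)

theorem tensorRel_pull (A B : Set Allen) :
    tensorRel (pull Allen.of A) (pull Allen.of B) = pull Region.of (A ×ˢ B) := rfl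

theorem tensorClass_pull (𝒜 ℬ : Set (Set Allen)) :
    tensorClass (pull Allen.of '' 𝒜) (pull Allen.of '' ℬ) =
      pull Region.of '' AtomTable.tensor 𝒜 ℬ := by
  ext Q
  constructor
  · rintro ⟨_, ⟨A, hA, rfl⟩, _, ⟨B, hB, rfl⟩, rfl⟩
    exact ⟨_, ⟨A, hA, B, hB, rfl⟩, (tensorRel_pull A B).symm⟩
  · rintro ⟨_, ⟨A, hA, B, hB, rfl⟩, rfl⟩
    exact ⟨_, ⟨A, hA, rfl⟩, _, ⟨B, hB, rfl⟩, (tensorRel_pull A B).symm⟩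

/-- The two coordinates are independent: triangles of intervals chosen separately in `x` and `y` are
realised together by rectangles. -/
theorem presents_RA : Presents (Allen.table.prod Allen.table) Region.of RA where
  mem_iff R := by
    have h : {Q | ∃ α β : Allen, Q = tensorRel α.rel β.rel} =
        Set.range fun p : Allen × Allen => pull Region.of {p} := by
      ext Q
      simp only [Allen.rel_eq_pull, tensorRel_pull, Set.singleton_prod_singleton]
      exact ⟨fun ⟨α, β, h⟩ => ⟨(α, β), h.symm⟩, fun ⟨p, h⟩ => ⟨p.1, p.2, h.symm⟩⟩
    rw [RA, h, mem_closure_range_pull]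
  idx_swap a a' := Prod.ext (Allen.of_swap _ _) (Allen.of_swap _ _)
  tri_iff a b c := by
    constructor
    · rintro ⟨h, h'⟩
      obtain ⟨x, y, z, h₁, h₂, h₃⟩ := (Allen.tri_iff ..).1 h
      obtain ⟨x', y', z', h₁', h₂', h₃'⟩ := (Allen.tri_iff ..).1 h'
      refine ⟨.rectangle x x', .rectangle y y', .rectangle z z', ?_, ?_, ?_⟩ <;>
        rw [Region.of] <;> simp only [Region.Ix_rectangle, Region.Iy_rectangle] <;>
        apply Prod.ext <;> assumption
    · rintro ⟨x, y, z, rfl, rfl, rfl⟩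
      exact ⟨(Allen.tri_iff ..).2 ⟨_, _, _, rfl, rfl, rfl⟩,
        (Allen.tri_iff ..).2 ⟨_, _, _, rfl, rfl, rfl⟩⟩

/-! ### The maximal distributive subalgebras -/

namespace Allen

/-- The two maximal distributive subalgebras, as classes of sets of basic interval relations. -/
def maxClass (t : Bool) : Set (Set Allen) := bif t then convexClass else sClass

theorem isDistributive_maxClass : ∀ t, table.IsDistributive (maxClass t)
  | true => isDistributive_convexClass
  | false => isDistributive_sClass

theorem exists_subset_maxClass {𝒜 : Set (Set Allen)} (h : table.IsDistributive 𝒜) :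
    ∃ t, 𝒜 ⊆ maxClass t :=
  (subset_convexClass_or_subset_sClass h).elim (fun h => ⟨true, h⟩) fun h => ⟨false, h⟩

theorem maxClass_subset_maxClass : ∀ t t', maxClass t ⊆ maxClass t' → t = t'
  | true, true, _ | false, false, _ => rfl
  | true, false, h => absurd h not_convexClass_subset_sClass
  | false, true, h => absurd h not_sClass_subset_convexClass

/-- The four maximal distributive subalgebras of the Rectangle Algebra, as classes of sets of
atoms. -/
def maxClass₂ (t : Bool × Bool) : Set (Set (Allen × Allen)) :=
  AtomTable.tensor (maxClass t.1) (maxClass t.2)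

theorem isDistributive_maxClass₂ (t : Bool × Bool) :
    (table.prod table).IsDistributive (maxClass₂ t) :=
  (isDistributive_maxClass t.1).tensor (isDistributive_maxClass t.2)

theorem exists_subset_maxClass₂ {ℛ : Set (Set (Allen × Allen))}
    (h : (table.prod table).IsDistributive ℛ) : ∃ t, ℛ ⊆ maxClass₂ t := by
  obtain ⟨t, ht⟩ := exists_subset_maxClass h.fst
  obtain ⟨t', ht'⟩ := exists_subset_maxClass h.snd
  exact ⟨(t, t'), h.subset_tensor.trans (AtomTable.tensor_mono ht ht')⟩

theorem maxClass₂_subset_maxClass₂ (t t' : Bool × Bool) (h : maxClass₂ t ⊆ maxClass₂ t') :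
    t = t' := by
  have := AtomTable.subset_of_tensor_subset (isDistributive_maxClass _) (isDistributive_maxClass _)
    (isDistributive_maxClass _) (isDistributive_maxClass _) h
  exact Prod.ext (maxClass_subset_maxClass _ _ this.1) (maxClass_subset_maxClass _ _ this.2)

end Allen

open Allen in
theorem setOf_isMaximalDistributive_IA :
    {𝒮 | IsMaximalDistributive IA 𝒮} = {convexIA, sIA} := by
  rw [presents_IA.setOf_isMaximalDistributive isDistributive_maxClass
    (fun _ => exists_subset_maxClass) maxClass_subset_maxClass, convexIA_eq, sIA_eq]
  ext 𝒮
  simp [maxClass, or_comm]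

open Allen in
theorem convexIA_ne_sIA : convexIA ≠ sIA := by
  rw [convexIA_eq, sIA_eq]
  exact fun h => not_convexClass_subset_sClass
    (presents_IA.pull_injective.image_injective h).subset

open Allen in
theorem setOf_isMaximalDistributive_RA :
    {𝒮 | IsMaximalDistributive RA 𝒮} = Set.range fun t => pull Region.of '' maxClass₂ t :=
  presents_RA.setOf_isMaximalDistributive isDistributive_maxClass₂
    (fun _ => exists_subset_maxClass₂) maxClass₂_subset_maxClass₂

open Allen in
theorem ncard_isMaximalDistributive_RA : {𝒮 | IsMaximalDistributive RA 𝒮}.ncard = 4 := by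
  have hinj : Function.Injective fun t => pull Region.of '' maxClass₂ t := fun t t' h =>
    maxClass₂_subset_maxClass₂ t t' (presents_RA.pull_injective.image_injective h).subset
  rw [setOf_isMaximalDistributive_RA, ← Set.image_univ, Set.ncard_image_of_injective _ hinj,
    Set.ncard_univ]
  simp

open Allen in
theorem setOf_isMaximalDistributive_RA_eq :
    {𝒮 | IsMaximalDistributive RA 𝒮} = {tensorClass convexIA convexIA, tensorClass convexIA sIA,
      tensorClass sIA convexIA, tensorClass sIA sIA} := by
  rw [setOf_isMaximalDistributive_RA, convexIA_eq, sIA_eq]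
  simp only [tensorClass_pull]
  ext 𝒮
  constructor
  · rintro ⟨⟨_ | _, _ | _⟩, rfl⟩
    exacts [.inr (.inr (.inr rfl)), .inr (.inr (.inl rfl)), .inr (.inl rfl), .inl rfl]
  · rintro (rfl | rfl | rfl | rfl)
    exacts [⟨(true, true), rfl⟩, ⟨(true, false), rfl⟩, ⟨(false, true), rfl⟩,
      ⟨(false, false), rfl⟩]

end QCalc

theorem mainTheorem3 :
    ({𝒮 | QCalc.IsMaximalDistributive QCalc.IA 𝒮} = {QCalc.convexIA, QCalc.sIA} ∧
      QCalc.convexIA ≠ QCalc.sIA) ∧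
    ({𝒮 | QCalc.IsMaximalDistributive QCalc.RA 𝒮} =
        {QCalc.tensorClass QCalc.convexIA QCalc.convexIA,
          QCalc.tensorClass QCalc.convexIA QCalc.sIA,
          QCalc.tensorClass QCalc.sIA QCalc.convexIA,
          QCalc.tensorClass QCalc.sIA QCalc.sIA} ∧
      {𝒮 | QCalc.IsMaximalDistributive QCalc.RA 𝒮}.ncard = 4) :=
  ⟨⟨QCalc.setOf_isMaximalDistributive_IA, QCalc.convexIA_ne_sIA⟩,
    QCalc.setOf_isMaximalDistributive_RA_eq, QCalc.ncard_isMaximalDistributive_RA⟩
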